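/- **Setting.** A conjunctive query $Q(F)=R_1(\mathbf X_1),\dots,R_k(\mathbf X_k)$ is given by a set of body atoms, each over a tuple (schema) of distinct variables, and a set $F=\mathrm{free}(Q)$ of variables occurring in the body; the other variables are bound. Every relation symbol, and so every atom, is either static or dynamic (subject to inserts and deletes). A *path* is a non-empty sequence of variables in which any two consecutive ones occur together in a body atom; it connects two body atoms (respectively, a body atom and the head atom) if its first variable is in the schema of the first atom and its last variable is in the schema of the second (respectively, is free). $Q$ is in $\mathcal C_{\mathrm{poly}}$ (is *well-behaved*) if every path $P$ connecting two dynamic body atoms $R(\mathbf X),S(\mathbf Y)$ satisfies $P\cap\mathbf X\cap\mathbf Y\neq\emptyset$, and every path $P$ connecting a dynamic body atom $R(\mathbf X)$ with the head atom satisfies $P\cap\mathbf X\cap\mathrm{free}(Q)\ne\emptyset$. The connected components of $Q$ are those of its body atoms, where atoms sharing a variable are connected. **Variable orders.** A *variable order* (VO) $\omega$ for $Q$ is a rooted forest in which each variable of $Q$ is exactly one inner node and each body atom is exactly one leaf, such that the variables of each atom lie on the path from a root to that atom and each atom is a child of its lowest variable (an atom without variables is a root). It is *canonical* if, for every dynamic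 atom, the variables of the atom are all inner nodes on its root-to-leaf path; it is *free-top* if no bound variable is an ancestor of a free variable; it is *well-structured* if it is canonical and free-top. Let $\mathrm{dep}_\omega(X)$ be the set of those ancestors of $X$ that occur in an atom together with a variable of the subtree rooted at $X$ (which includes $X$), and let $Q_X$ be the query that joins all atoms in this subtree. The *preprocessing width* of $\omega$ is $\mathsf w(\omega)=\max_X\rho^*_{Q_X}(\{X\}\cup\mathrm{dep}_\omega(X))$ (and $0$ if there are no variables), where $\rho^*$ is the fractional edge cover number. The preprocessing width $\mathsf w(Q)$ is the minimum of $\mathsf w(\omega)$ over all well-structured VOs $\omega$ for $Q$. **View trees.** $\mathrm{Rewrite}(\omega)$ contains one view tree for each tree of $\omega$: each atom becomes a leaf, and each variable $X$ becomes a join view $V_X(\{X\}\cup\mathrm{dep}_\omega(X))$ that joins the views obtained from the children of $X$, with on top of it, as its parent, the projection view $V'_X(\mathrm{dep}_\omega(X))$, which projects $X$ away. A set $\mathcal T$ of view trees, with body atoms of $Q$ as leaves (each occurring once) and with join views (whose schema is the union of the schemas of their children) and projection views (whose schema is contained in the schema of their only child) as inner nodes, is a *safe rewriting* of $Q$ if: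 * (Correctness) all atoms of each connected component of $Q$ are in one tree of $\mathcal T$; and if a projection view projects away a variable $X$, then all atoms of $Q$ containing $X$ are in the subtree rooted at that view. * (Update) the set of free variables of each dynamic view (a view with a dynamic atom in its subtree) contains the set of free variables of each of its siblings. * (Enumeration) each tree $T\in\mathcal T$ has a subtree $T'$ with the same root such that the set of free variables of the views in $T'$ is the set of free variables of $Q$ that occur in the atoms of $T$ (if the atoms of $T$ form one connected component of $Q$, these are the free variables of this component). **Computation time.** Time is counted on a machine whose relations are stored in data structures with constant-time insertion and lookup of a tuple, constant-time access to the number of tuples that agree with given values in given columns, and constant-delay enumeration of these tuples. A set of view trees *can be materialised in $O(N^{w})$ time* if there are a program and a constant $C$, neither depending on the database, such that the program, on every database with $N$ tuples in the relations of $Q$, stores exactly the content of every view of the trees, in at most $C\cdot\max(1,N)^w$ steps. **Proposition.** Let $Q$ be a query in $\mathcal C_{\mathrm{poly}}$ and $\omega$ a well-structured VO for $Q$. Then $\mathrm{Rewrite}(\omega)$ is a safe rewriting of $Q$, and it can be materialised in $O(N^{\mathsf w(\omega)})$ time. Moreover, $\mathsf w(Q)$ is attained by some well-structured VO $\omega_0$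 for $Q$, so $\mathrm{Rewrite}(\omega_0)$ is a safe rewriting of $Q$ that can be materialised in $O(N^{\mathsf w(Q)})$ time. -/

import Mathlib

open scoped NNReal

universe u v x

/-! ## Conjunctive queries over static and dynamic relations -/

/-- A relational signature: every relation symbol has an arity, and is either dynamic (subject to
inserts and deletes) or static. -/
structure Signature (R : Type*) where
  arity : R → ℕ
  dynamic : R → Prop

/-- An atom `R(X₁, …, Xₙ)`; its schema is a tuple of distinct variables. -/
@[ext]
structure QAtom {R : Type*} (σ : Signature R) (V : Type*) where
  sym : R
  args : List V
  nodup : args.Nodup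
  length_eq : args.length = σ.arity sym

namespace QAtom

variable {R V : Type*} {σ : Signature R}

noncomputable instance : DecidableEq (QAtom σ V) := Classical.decEq _

/-- The set of variables of an atom. -/
def vars [DecidableEq V] (A : QAtom σ V) : Finset V := A.args.toFinset

/-- An atom is dynamic if its relation symbol is. -/
def IsDynamic (A : QAtom σ V) : Prop := σ.dynamic A.sym

end QAtom

/-- A conjunctive query `Q(free) = body`. -/
structure CQ {R : Type*} (σ : Signature R) (V : Type*) [DecidableEq V] where
  body : Finset (QAtom σ V)
  free : Finset V
  free_subset : free ⊆ body.biUnion QAtom.vars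

namespace CQ

variable {R V : Type*} [DecidableEq V] {σ : Signature R}

/-- The variables of a query. -/
def vars (Q : CQ σ V) : Finset V := Q.body.biUnion QAtom.vars

/-- Two variables are adjacent if some body atom contains both. -/
def Adj (Q : CQ σ V) (X Y : V) : Prop := ∃ A ∈ Q.body, X ∈ A.vars ∧ Y ∈ A.vars

/-- `P` is a path `(X = X₁, …, Xₙ = Y)`, `n ≥ 1`: any two consecutive variables lie in a common
body atom. -/
def IsPath (Q : CQ σ V) (P : List V) (X Y : V) : Prop :=
  P.head? = some X ∧ P.getLast? = some Y ∧ P.IsChain Q.Adj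

/-- Every path that connects two dynamic body atoms is body-safe: it meets the intersection of the
schemas of the two atoms. -/
def BodySafe (Q : CQ σ V) : Prop :=
  ∀ A ∈ Q.body, ∀ B ∈ Q.body, A.IsDynamic → B.IsDynamic →
    ∀ (P : List V) (X Y : V), Q.IsPath P X Y → X ∈ A.vars → Y ∈ B.vars →
      ∃ Z ∈ P, Z ∈ A.vars ∧ Z ∈ B.vars

/-- Every path that connects a dynamic body atom with the head atom is head-safe: it contains a free
variable of the body atom. -/
def HeadSafe (Q : CQ σ V) : Prop :=
  ∀ A ∈ Q.body, A.IsDynamic →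
    ∀ (P : List V) (X Y : V), Q.IsPath P X Y → X ∈ A.vars → Y ∈ Q.free →
      ∃ Z ∈ P, Z ∈ A.vars ∧ Z ∈ Q.free

/-- Well-behaved queries. The class `C_poly` is the class of all well-behaved queries. -/
def WellBehaved (Q : CQ σ V) : Prop := Q.BodySafe ∧ Q.HeadSafe

/-- `A` and `B` lie in the same connected component of the body of `Q`: there is a sequence of body
atoms from `A` to `B` in which consecutive atoms share a variable. -/
def SameComponent (Q : CQ σ V) : QAtom σ V → QAtom σ V → Prop :=
  Relation.ReflTransGen fun A B => A ∈ Q.body ∧ B ∈ Q.body ∧ ¬ Disjoint A.vars B.vars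

end CQ

/-- The fractional edge cover number of the variable set `F`, in the query that joins the atoms
in `E`. -/
noncomputable def fractionalCoverNumber {R V : Type*} [DecidableEq V] {σ : Signature R}
    (E : Finset (QAtom σ V)) (F : Finset V) : ℝ≥0 :=
  sInf {c | ∃ lam : QAtom σ V → ℝ≥0, (∀ A ∈ E, lam A ≤ 1) ∧
    (∀ X ∈ F, 1 ≤ ∑ A ∈ E with X ∈ A.vars, lam A) ∧ c = ∑ A ∈ E, lam A}

/-! ## Variable orders -/

/-- A rooted tree whose inner nodes are variables and whose leaves are atoms. A forest of such trees
is represented by a list. -/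
inductive VOTree {R : Type*} (σ : Signature R) (V : Type*) where
  | atom (A : QAtom σ V) : VOTree σ V
  | var (X : V) (k : ℕ) (children : Fin k → VOTree σ V) : VOTree σ V

namespace VOTree

variable {R V : Type*} {σ : Signature R}

/-- The variables of a tree, with multiplicity. -/
def vars : VOTree σ V → Multiset V
  | atom _ => 0
  | var X _ c => X ::ₘ ∑ i, (c i).vars

/-- The atoms of a tree, with multiplicity. -/
def atoms : VOTree σ V → Multiset (QAtom σ V)
  | atom A => {A}
  | var _ _ c => ∑ i, (c i).atoms

variable [DecidableEq V]

/-- Below a path whose set of variables is `anc` and whose last variable is `par` (`none` at the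
top): the variables of every atom lie on its root-to-leaf path, and every atom is a child of its
lowest variable (an atom without variables is a root). -/
def Placed : VOTree σ V → Finset V → Option V → Prop
  | atom A, anc, par => A.vars ⊆ anc ∧ ∀ X ∈ par, X ∈ A.vars
  | var X _ c, anc, _ => ∀ i, (c i).Placed (insert X anc) (some X)

/-- Canonical, below a path with variables `anc`: the set of variables of every dynamic atom is the
set of inner nodes of the root-to-leaf path that ends with it. -/
def Canonical : VOTree σ V → Finset V → Prop
  | atom A, anc => A.IsDynamic → A.vars = anc
  | var X _ c, anc => ∀ i, (c i).Canonical (insert X anc)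

/-- Free-top with respect to the free variables `F`, below a path with variables `anc`: no bound
variable is an ancestor of a free variable. -/
def FreeTop (F : Finset V) : VOTree σ V → Finset V → Prop
  | atom _, _ => True
  | var X _ c, anc => (X ∈ F → anc ⊆ F) ∧ ∀ i, (c i).FreeTop F (insert X anc)

open scoped Classical in
/-- The dependency set of the root of `t`, whose ancestors are `anc`: the ancestors that occur in
an atom of `Q` together with a variable of `t`. -/
noncomputable def dep (Q : CQ σ V) (t : VOTree σ V) (anc : Finset V) : Finset V :=
  anc.filter fun Y => ∃ A ∈ Q.body, Y ∈ A.vars ∧ ∃ Z ∈ t.vars, Z ∈ A.vars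

/-- The maximum, over the variables `X` of the tree, of the fractional edge cover number of
`{X} ∪ dep(X)` in the query `Q_X` that joins the atoms in the subtree rooted at `X`. -/
noncomputable def width (Q : CQ σ V) : VOTree σ V → Finset V → ℝ≥0
  | atom _, _ => 0
  | var X k c, anc =>
      max (fractionalCoverNumber (var X k c).atoms.toFinset
          (insert X (dep Q (var X k c) anc)))
        (Finset.univ.sup fun i => (c i).width Q (insert X anc))

end VOTree

/-! ## View trees -/

/-- A tree whose leaves are atoms and whose inner nodes are join views or projection views, each with
its schema (its set of free variables). -/
inductive ViewTree {R : Type*} (σ : Signature R) (V : Type*) where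
  | atom (A : QAtom σ V) : ViewTree σ V
  | join (S : Finset V) (k : ℕ) (children : Fin k → ViewTree σ V) : ViewTree σ V
  | proj (S : Finset V) (child : ViewTree σ V) : ViewTree σ V

/-- A database over `σ` with values in `Dom`. -/
structure Database {R : Type*} (σ : Signature R) (Dom : Type*) where
  rel : R → Finset (List Dom)
  length_eq : ∀ r, ∀ t ∈ rel r, t.length = σ.arity r

open scoped Classical in
/-- The size of a database: the number of tuples in the relations of `Q`. -/
noncomputable def Database.size {R V Dom : Type*} [DecidableEq V] {σ : Signature R}
    (D : Database σ Dom) (Q : CQ σ V) : ℕ :=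
  ∑ r ∈ Q.body.image QAtom.sym, (D.rel r).card

namespace ViewTree

variable {R V : Type*} {σ : Signature R}

/-- The leaf atoms of a tree, with multiplicity. -/
def leaves : ViewTree σ V → Multiset (QAtom σ V)
  | atom A => {A}
  | join _ _ c => ∑ i, (c i).leaves
  | proj _ c => c.leaves

/-- The children of a node, the leftmost one having number `0`. -/
def child : ViewTree σ V → ℕ → Option (ViewTree σ V)
  | atom _, _ => none
  | join _ k c, i => if h : i < k then some (c ⟨i, h⟩) else none
  | proj _ c, i => if i = 0 then some c else none

/-- The subtree at the node that is reached from the root along a list of child numbers. -/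
def nodeAt (T : ViewTree σ V) : List ℕ → Option (ViewTree σ V)
  | [] => some T
  | i :: p => (T.child i).bind fun T' => T'.nodeAt p

/-- `S` is the subtree of `T` rooted at some node of `T`. -/
def IsNode (S T : ViewTree σ V) : Prop := ∃ p, T.nodeAt p = some S

/-- A view is dynamic if there is a dynamic atom in its subtree. -/
def IsDynamic (T : ViewTree σ V) : Prop := ∃ A ∈ T.leaves, A.IsDynamic

/-- The content of a view in the database `D`, as a set of valuations of the variables: a join view
is the natural join of its children, a projection view the projection of its child. -/
def Sat {Dom : Type*} (D : Database σ Dom) : ViewTree σ V → (V → Dom) → Prop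
  | atom A, a => A.args.map a ∈ D.rel A.sym
  | join _ _ c, a => ∀ i, (c i).Sat D a
  | proj S c, a => ∃ b : V → Dom, (∀ X ∈ S, b X = a X) ∧ c.Sat D b

variable [DecidableEq V]

/-- The schema of the root of a view tree. -/
def schema : ViewTree σ V → Finset V
  | atom A => A.vars
  | join S _ _ => S
  | proj S _ => S

/-- The schema of a join view is the union of the schemas of its children; the schema of a projection
view is contained in the schema of its child. -/
def WellFormed : ViewTree σ V → Prop
  | atom _ => True
  | join S _ c => S = Finset.univ.biUnion (fun i => (c i).schema) ∧ ∀ i, (c i).WellFormed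
  | proj S c => S ⊆ c.schema ∧ c.WellFormed

/-- `P` is the set of nodes of a subtree of `T` with the same root as `T`: it contains the root, and
with each node its parent. -/
def IsRootSubtree (T : ViewTree σ V) (P : Finset (List ℕ)) : Prop :=
  [] ∈ P ∧ (∀ p i, p ++ [i] ∈ P → p ∈ P) ∧ ∀ p ∈ P, (T.nodeAt p).isSome

/-- The set of free variables of the views at the nodes in `P`. -/
def varsAt (T : ViewTree σ V) (P : Finset (List ℕ)) : Finset V :=
  P.biUnion fun p => (T.nodeAt p).elim ∅ schema

end ViewTree

/-! ## Rewritings -/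

section Rewriting

variable {R V : Type*} [DecidableEq V] {σ : Signature R}

/-- The view trees are well formed, and their leaves are the body atoms of `Q`, each occurring
once. -/
def IsRewriting (Q : CQ σ V) (F : List (ViewTree σ V)) : Prop :=
  (∀ T ∈ F, T.WellFormed) ∧ (F.map ViewTree.leaves).sum = Q.body.val

/-- Correctness: (1) the atoms of every connected component of `Q` lie in one view tree; (2) if a
projection view projects away the variable `X`, then all atoms of `Q` that contain `X` lie in the
subtree rooted at this view. -/
def CorrectnessProperty (Q : CQ σ V) (F : List (ViewTree σ V)) : Prop :=
  (∀ A ∈ Q.body, ∃ T ∈ F, ∀ B ∈ Q.body, Q.SameComponent A B → B ∈ T.leaves) ∧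
  ∀ T ∈ F, ∀ S c, (ViewTree.proj S c).IsNode T → ∀ X ∈ c.schema \ S,
    ∀ A ∈ Q.body, X ∈ A.vars → A ∈ c.leaves

/-- Update property: the set of free variables of every dynamic view contains the set of free
variables of each of its siblings. -/
def UpdateProperty (F : List (ViewTree σ V)) : Prop :=
  ∀ T ∈ F, ∀ (p : List ℕ) (i j : ℕ) (S S' : ViewTree σ V), i ≠ j →
    T.nodeAt (p ++ [i]) = some S → T.nodeAt (p ++ [j]) = some S' →
      S.IsDynamic → S'.schema ⊆ S.schema

open scoped Classical in
/-- Enumeration property: every view tree has a subtree with the same root such that the set of free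
variables of the views in this subtree is the set of those free variables of `Q` that occur in the
atoms of the tree. (If these atoms form one connected component of `Q`, that set is the set of free
variables of the component.) -/
def EnumerationProperty (Q : CQ σ V) (F : List (ViewTree σ V)) : Prop :=
  ∀ T ∈ F, ∃ P : Finset (List ℕ), T.IsRootSubtree P ∧
    T.varsAt P = Q.free ∩ T.leaves.toFinset.biUnion QAtom.vars

/-- Safe rewritings of `Q`. -/
structure IsSafeRewriting (Q : CQ σ V) (F : List (ViewTree σ V)) : Prop where
  isRewriting : IsRewriting Q F
  correctness : CorrectnessProperty Q F
  update : UpdateProperty F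
  enumeration : EnumerationProperty Q F

/-- A variable order (VO) for `Q`: the variables and the body atoms of `Q` each occur exactly once,
the variables of each atom lie on a root-to-leaf path, and each atom is placed under its lowest
variable. -/
def IsVO (Q : CQ σ V) (ω : List (VOTree σ V)) : Prop :=
  (ω.map VOTree.vars).sum = Q.vars.val ∧ (ω.map VOTree.atoms).sum = Q.body.val ∧
    ∀ t ∈ ω, t.Placed ∅ none

/-- A VO for `Q` is well-structured if it is canonical and free-top. -/
def IsWellStructuredVO (Q : CQ σ V) (ω : List (VOTree σ V)) : Prop :=
  IsVO Q ω ∧ (∀ t ∈ ω, t.Canonical ∅) ∧ ∀ t ∈ ω, t.FreeTop Q.free ∅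

/-- The preprocessing width of a VO. -/
noncomputable def voWidth (Q : CQ σ V) (ω : List (VOTree σ V)) : ℝ≥0 :=
  (ω.map fun t => t.width Q ∅).foldr max 0

/-- The preprocessing width of a query: the minimal width of its well-structured VOs. -/
noncomputable def preprocessingWidth (Q : CQ σ V) : ℝ≥0 :=
  sInf {w | ∃ ω, IsWellStructuredVO Q ω ∧ w = voWidth Q ω}

/-- The view tree that follows a VO tree: a variable `X` gives the join view `V_X({X} ∪ dep(X))` of
the views of its children, and on top of it the projection view `V'_X(dep(X))`. -/
noncomputable def buildViewTree (Q : CQ σ V) : VOTree σ V → Finset V → ViewTree σ V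
  | .atom A, _ => .atom A
  | .var X k c, anc =>
      .proj (VOTree.dep Q (.var X k c) anc)
        (.join (insert X (VOTree.dep Q (.var X k c) anc)) k
          fun i => buildViewTree Q (c i) (insert X anc))

/-- The procedure `Rewrite`: one view tree for each tree of the VO. -/
noncomputable def rewriteVO (Q : CQ σ V) (ω : List (VOTree σ V)) : List (ViewTree σ V) :=
  ω.map fun t => buildViewTree Q t ∅

end Rewriting

/-! ## Computation time

Programs work on finitely many registers that hold domain values and on relations that are stored
under names of type `ν`. Every elementary operation is one that the usual data structures for
relations (hash tables with linked entries, and hash indexes on sets of columns) support in constant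
time on a RAM: insert a tuple, look up a tuple, get the number of tuples that agree with given values
in given columns, and go to the next such tuple. A program text uses only finitely many index
patterns and contains no domain values. -/

/-- Programs. A selection `sel : List (Option ℕ)` gives for each column either a register whose value
the column must have, or no condition. -/
inductive Prog (ν : Type*) where
  | skip : Prog ν
  | seq (p q : Prog ν) : Prog ν
  /-- Insert into `r` the tuple held by the registers `t`, unless it is already there. -/
  | insert (r : ν) (t : List ℕ) : Prog ν
  /-- Run `p` if `r` contains the tuple held by the registers `t`, otherwise `q`. -/
  | ifMem (r : ν) (t : List ℕ) (p q : Prog ν) : Prog ν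
  /-- Run `p` if at most as many tuples of `r` match `sel` as tuples of `r'` match `sel'`,
  otherwise `q`. -/
  | ifCountLe (r : ν) (sel : List (Option ℕ)) (r' : ν) (sel' : List (Option ℕ)) (p q : Prog ν) :
      Prog ν
  /-- For each tuple of `r` that matches `sel` when the loop is entered: load it into the registers
  `out` and run `p`. -/
  | forEach (r : ν) (sel : List (Option ℕ)) (out : List ℕ) (p : Prog ν) : Prog ν

/-- The state of a computation; relations are stored as lists of tuples. -/
structure PState (ν Dom : Type*) where
  reg : ℕ → Dom
  store : ν → List (List Dom)

namespace Prog

variable {ν Dom : Type*} [DecidableEq ν] [DecidableEq Dom]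

/-- Does a tuple match a selection? -/
def matchSel (reg : ℕ → Dom) : List (Option ℕ) → List Dom → Bool
  | [], [] => true
  | none :: s, _ :: t => matchSel reg s t
  | some r :: s, d :: t => decide (reg r = d) && matchSel reg s t
  | _, _ => false

/-- The tuples of a stored relation that match a selection. -/
def selected (s : PState ν Dom) (r : ν) (sel : List (Option ℕ)) : List (List Dom) :=
  (s.store r).filter (matchSel s.reg sel)

/-- Load a tuple into registers. -/
def load : List ℕ → List Dom → (ℕ → Dom) → ℕ → Dom
  | r :: rs, d :: ds, reg => load rs ds (Function.update reg r d)
  | _, _, reg => reg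

/-- Run a program; the result is the final state and the number of elementary steps. -/
def exec : Prog ν → PState ν Dom → PState ν Dom × ℕ
  | skip, s => (s, 1)
  | seq p q, s =>
      let a := exec p s
      let b := exec q a.1
      (b.1, a.2 + b.2)
  | insert r t, s =>
      (if t.map s.reg ∈ s.store r then s
        else { s with store := Function.update s.store r (s.store r ++ [t.map s.reg]) }, 1)
  | ifMem r t p q, s =>
      let a := if t.map s.reg ∈ s.store r then exec p s else exec q s
      (a.1, a.2 + 1)
  | ifCountLe r sel r' sel' p q, s =>
      let a := if (selected s r sel).length ≤ (selected s r' sel').length then exec p s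
        else exec q s
      (a.1, a.2 + 1)
  | forEach r sel out p, s =>
      (selected s r sel).foldl
        (fun acc t =>
          let a := exec p { acc.1 with reg := load out t acc.1.reg }
          (a.1, acc.2 + a.2 + 1))
        (s, 1)

end Prog

section Materialisation

variable {R V Dom : Type*} {σ : Signature R}

/-- The initial states for the database `D`: the relations of `D` are listed, without repetition, in
any order under their own names, all other names hold the empty relation, and the contents of the
registers are arbitrary. -/
def PState.Represents (s : PState (R ⊕ ℕ) Dom) (D : Database σ Dom) : Prop :=
  (∀ r, (s.store (.inl r)).Nodup ∧ ∀ t, t ∈ s.store (.inl r) ↔ t ∈ D.rel r) ∧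
    ∀ n, s.store (.inr n) = []

/-- The list `L` of tuples stores, without repetition, the set `P` of valuations restricted to the
columns `cols`. -/
def Stores (L : List (List Dom)) (cols : List V) (P : (V → Dom) → Prop) : Prop :=
  L.Nodup ∧ ∀ t, t ∈ L ↔ ∃ a, P a ∧ t = cols.map a

/-- All views in the view trees `F` for `Q` can be materialised in time `O(N ^ w)`, where `N` is the
database size: there is one program which, on every database, leaves every view `S` of `F` stored
under the name `loc S` with columns `cols S`, and makes at most `C * max(1, N) ^ w` steps. The
program and the constant `C` do not depend on the database or its domain. -/
def MaterialisableInTime {R : Type u} {V : Type v} [DecidableEq R] [DecidableEq V]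
    {σ : Signature R} (Q : CQ σ V) (F : List (ViewTree σ V)) (w : ℝ≥0) : Prop :=
  ∃ (prog : Prog (R ⊕ ℕ)) (loc : ViewTree σ V → R ⊕ ℕ) (cols : ViewTree σ V → List V) (C : ℝ),
    (∀ T ∈ F, ∀ S : ViewTree σ V, S.IsNode T → (cols S).Nodup ∧ (cols S).toFinset = S.schema) ∧
    ∀ (Dom : Type x) [DecidableEq Dom] [Nonempty Dom] (D : Database σ Dom)
      (s : PState (R ⊕ ℕ) Dom), s.Represents D →
        (∀ T ∈ F, ∀ S : ViewTree σ V, S.IsNode T →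
          Stores ((prog.exec s).1.store (loc S)) (cols S) (S.Sat D)) ∧
        ((prog.exec s).2 : ℝ) ≤ C * (max 1 (D.size Q) : ℝ) ^ (w : ℝ)

end Materialisation

/-!
The rewriting follows the variable order, so its safety is read off the shape of the order. The
decisive fact, the field `closed` of `VOTree.IsSubVO`, is that a subtree of the order contains as
leaves all atoms of `Q` in which one of its variables occurs: the variables of an atom lie on its
root-to-leaf path, and each variable is only one node. Hence a variable that is projected away no
longer occurs outside the subtree, and the schema of the join view `V_X` is the union of the
schemas of its children (`VOTree.IsSubVO.insert_dep_eq`). Every child of `V_X` has a schema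
contained in `X` and its ancestors; if the order is canonical, a dynamic child has all of them
(`VOTree.IsSubVO.update`). If the order is free-top, the views of the free variables and their
children form a subtree at the root (`VOTree.IsSubVO.exists_rootSubtree`).

The view `V_X` is contained in the join of the atoms below `X`, projected to the schema `F` of
`V_X` (`VOTree.IsSubVO.inJoin`). The program computes a superset of `V_X` one variable at a time
(`Prog.joinAtoms`): a tuple `t` over the variables `bs` is extended by the values of the next
variable that occur in an atom with fewest tuples agreeing with `t`, and the extended tuple is kept
if each atom has a tuple that agrees with it. For a fractional edge cover `λ`, give `t` the weight
`∏ (number of tuples of A that agree with t) ^ λ_A`. By Hölder's inequality, the total weight of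
the extensions of `t` by a variable is at most the weight of `t`, so the weights of the tuples over
`bs` add up to at most `∏ |A| ^ λ_A ≤ N ^ (∑ λ_A)` (`sum_prod_matchCount_le`). This bounds the
number of the tuples, whose weights are at least `1`, as well as the number of the candidates,
which for each tuple is at most its weight. The algorithm does not depend on `λ`, so the infimum
over all covers is a bound, too (`sum_le_rpow_fractionalCoverNumber`). The superset is then
filtered by membership in the views of the children of `X`.

Programs only ever insert tuples (`Prog.le_exec`). Therefore, it suffices to fix the intended
content of each name in advance (`target`), to show that only intended tuples are inserted
(`PState.Sound`), and that in the end all of them are there (`PState.Full`).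

Finally, the width of a query is a minimum since only finitely many numbers can be the width of a
variable order for `Q` (`exists_voWidth_eq`).
-/

/-! ### Subtrees of variable orders -/

theorem List.mem_map_sum_multiset {α β : Type*} {f : α → Multiset β} {l : List α} {b : β} :
    b ∈ (l.map f).sum ↔ ∃ a ∈ l, b ∈ f a := by
  induction l with
  | nil => simp
  | cons a l ih => simp [ih]

namespace VOTree

variable {R : Type u} {V : Type v} {σ : Signature R}

theorem mem_vars_var {X Z : V} {k : ℕ} {c : Fin k → VOTree σ V} :
    Z ∈ (var X k c).vars ↔ Z = X ∨ ∃ i, Z ∈ (c i).vars := by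
  simp [vars, Multiset.mem_sum]

theorem mem_atoms_var {X : V} {A : QAtom σ V} {k : ℕ} {c : Fin k → VOTree σ V} :
    A ∈ (var X k c).atoms ↔ ∃ i, A ∈ (c i).atoms := by
  simp [atoms, Multiset.mem_sum]

variable [DecidableEq V]

/-- The conditions on a subtree `t` of a variable order for `Q`, below a path with variables `anc`
and last variable `par`, that are passed on to the children of `t`. The decisive one is `closed`:
all atoms of `Q` containing a variable of `t` are leaves of `t`. -/
structure IsSubVO (Q : CQ σ V) (t : VOTree σ V) (anc : Finset V) (par : Option V) : Prop where
  placed : t.Placed anc par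
  atoms_mem : ∀ A ∈ t.atoms, A ∈ Q.body
  vars_mem : ∀ X ∈ t.vars, X ∈ Q.vars
  closed : ∀ A ∈ Q.body, ∀ Z ∈ A.vars, Z ∈ t.vars → A ∈ t.atoms
  nodup : t.vars.Nodup
  disj : ∀ Z ∈ anc, Z ∉ t.vars

theorem Placed.vars_subset {t : VOTree σ V} {anc : Finset V} {par : Option V}
    (h : t.Placed anc par) {A : QAtom σ V} (hA : A ∈ t.atoms) {Z : V} (hZ : Z ∈ A.vars) :
    Z ∈ anc ∨ Z ∈ t.vars := by
  induction t generalizing anc par with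
  | atom B =>
    simp only [atoms, Multiset.mem_singleton] at hA
    subst hA
    exact Or.inl (h.1 hZ)
  | var X k c ih =>
    obtain ⟨i, hi⟩ := mem_atoms_var.1 hA
    rw [mem_vars_var]
    rcases ih i (h i) hi with h1 | h1
    · rcases Finset.mem_insert.1 h1 with h2 | h2 <;> simp [h2]
    · exact Or.inr (Or.inr ⟨i, h1⟩)

/-- An atom in a subtree rooted at a variable contains a variable of this subtree, namely its lowest
one. -/
theorem Placed.exists_mem_vars {X : V} {k : ℕ} {c : Fin k → VOTree σ V} {anc : Finset V}
    {par : Option V} (h : (var X k c).Placed anc par) {A : QAtom σ V}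
    (hA : A ∈ (var X k c).atoms) : ∃ Z ∈ A.vars, Z ∈ (var X k c).vars := by
  generalize ht : var X k c = t at *
  induction t generalizing anc par X k with
  | atom B => cases ht
  | var Y l d ih =>
    obtain ⟨i, hi⟩ := mem_atoms_var.1 hA
    have hp := h i
    cases hd : d i with
    | atom B =>
      rw [hd] at hi hp
      simp only [atoms, Multiset.mem_singleton] at hi
      subst hi
      exact ⟨Y, hp.2 Y rfl, mem_vars_var.2 (Or.inl rfl)⟩
    | var Z m e =>
      obtain ⟨W, h1, h2⟩ := ih i hd.symm hp hi
      exact ⟨W, h1, mem_vars_var.2 (Or.inr ⟨i, h2⟩)⟩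

theorem Canonical.subset_vars {t : VOTree σ V} {anc : Finset V} (h : t.Canonical anc)
    {A : QAtom σ V} (hA : A ∈ t.atoms) (hd : A.IsDynamic) : anc ⊆ A.vars := by
  induction t generalizing anc with
  | atom B =>
    simp only [atoms, Multiset.mem_singleton] at hA
    subst hA
    exact (h hd).ge
  | var X k c ih =>
    obtain ⟨i, hi⟩ := mem_atoms_var.1 hA
    exact (Finset.subset_insert _ _).trans (ih i (h i) hi)

/-- Below a bound variable, all variables are bound. -/
theorem FreeTop.notMem {F : Finset V} {t : VOTree σ V} {anc : Finset V} (h : t.FreeTop F anc)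
    (hanc : ¬ anc ⊆ F) {Z : V} (hZ : Z ∈ t.vars) : Z ∉ F := by
  induction t generalizing anc with
  | atom B => simp [vars] at hZ
  | var X k c ih =>
    rcases mem_vars_var.1 hZ with rfl | ⟨i, hi⟩
    · exact fun hF => hanc (h.1 hF)
    · exact ih i (h.2 i) (fun h' => hanc ((Finset.subset_insert _ _).trans h')) hi

theorem mem_dep {Q : CQ σ V} {t : VOTree σ V} {anc : Finset V} {Y : V} :
    Y ∈ dep Q t anc ↔ Y ∈ anc ∧ ∃ A ∈ Q.body, Y ∈ A.vars ∧ ∃ Z ∈ t.vars, Z ∈ A.vars := by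
  classical
  simp [dep]

theorem IsSubVO.child {Q : CQ σ V} {X : V} {k : ℕ} {c : Fin k → VOTree σ V} {anc : Finset V}
    {par : Option V} (h : IsSubVO Q (var X k c) anc par) (i : Fin k) :
    IsSubVO Q (c i) (insert X anc) (some X) := by
  have hnd := h.nodup
  rw [vars, Multiset.nodup_cons] at hnd
  have hle : ∀ i, (c i).vars ≤ ∑ i, (c i).vars := fun i =>
    Finset.single_le_sum (f := fun i => (c i).vars) (fun _ _ => Multiset.zero_le _)
      (Finset.mem_univ i)
  have hX : X ∉ (c i).vars := fun hx => hnd.1 (Multiset.mem_of_le (hle i) hx)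
  have hanc : ∀ Z ∈ anc, Z ∉ (c i).vars := fun Z hZ hZ' =>
    h.disj Z hZ (mem_vars_var.2 (Or.inr ⟨i, hZ'⟩))
  refine ⟨h.placed i, fun A hA => h.atoms_mem A (mem_atoms_var.2 ⟨i, hA⟩),
    fun Y hY => h.vars_mem Y (mem_vars_var.2 (Or.inr ⟨i, hY⟩)), ?_,
    Multiset.nodup_of_le (hle i) hnd.2, ?_⟩
  · intro A hA Z hZA hZ
    obtain ⟨j, hj⟩ := mem_atoms_var.1 (h.closed A hA Z hZA (mem_vars_var.2 (Or.inr ⟨i, hZ⟩)))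
    by_cases hij : j = i
    · exact hij ▸ hj
    exfalso
    rcases (h.placed j).vars_subset hj hZA with h1 | h1
    · rcases Finset.mem_insert.1 h1 with rfl | h2
      · exact hX hZ
      · exact hanc Z h2 hZ
    · have h2 : (c j).vars + (c i).vars ≤ ∑ i, (c i).vars := by
        have := Finset.sum_le_sum_of_subset (f := fun i => (c i).vars)
          (Finset.subset_univ ({j, i} : Finset (Fin k)))
        rwa [Finset.sum_pair hij] at this
      have h3 := (Multiset.nodup_add.1 (Multiset.nodup_of_le h2 hnd.2)).2.2
      exact Multiset.disjoint_left.1 h3 h1 hZ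
  · intro Z hZ
    rcases Finset.mem_insert.1 hZ with rfl | h2
    · exact hX
    · exact hanc Z h2

end VOTree

/-! ### Nodes of view trees -/

namespace ViewTree

variable {R : Type u} {V : Type v} {σ : Signature R}

theorem nodeAt_append (T : ViewTree σ V) (p q : List ℕ) :
    T.nodeAt (p ++ q) = (T.nodeAt p).bind fun U => U.nodeAt q := by
  induction p generalizing T with
  | nil => rfl
  | cons i p ih =>
    simp only [List.cons_append, nodeAt]
    cases T.child i with
    | none => rfl
    | some U => exact ih U

theorem nodeAt_singleton (T : ViewTree σ V) (i : ℕ) : T.nodeAt [i] = T.child i := by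
  simp only [nodeAt]
  cases T.child i <;> rfl

theorem isNode_self (T : ViewTree σ V) : T.IsNode T := ⟨[], rfl⟩

theorem IsNode.eq_of_atom {S : ViewTree σ V} {A : QAtom σ V} (h : S.IsNode (.atom A)) :
    S = .atom A := by
  obtain ⟨p, hp⟩ := h
  cases p with
  | nil => exact (Option.some.inj hp).symm
  | cons i p => simp [nodeAt, child] at hp

theorem IsNode.cases_join {S : ViewTree σ V} {F : Finset V} {k : ℕ} {c : Fin k → ViewTree σ V}
    (h : S.IsNode (.join F k c)) : S = .join F k c ∨ ∃ i, S.IsNode (c i) := by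
  obtain ⟨p, hp⟩ := h
  cases p with
  | nil => exact Or.inl (Option.some.inj hp).symm
  | cons i p =>
    by_cases hi : i < k
    · refine Or.inr ⟨⟨i, hi⟩, p, ?_⟩
      simpa [nodeAt, child, hi] using hp
    · simp [nodeAt, child, hi] at hp

theorem IsNode.cases_proj {S : ViewTree σ V} {F : Finset V} {c : ViewTree σ V}
    (h : S.IsNode (.proj F c)) : S = .proj F c ∨ S.IsNode c := by
  obtain ⟨p, hp⟩ := h
  cases p with
  | nil => exact Or.inl (Option.some.inj hp).symm
  | cons i p =>
    by_cases hi : i = 0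
    · refine Or.inr ⟨p, ?_⟩
      simpa [nodeAt, child, hi] using hp
    · simp [nodeAt, child, hi] at hp

theorem isRootSubtree_singleton (T : ViewTree σ V) : T.IsRootSubtree {[]} := by
  refine ⟨by simp, fun p i h => by simp at h, fun p hp => ?_⟩
  rw [Finset.mem_singleton] at hp
  subst hp
  rfl

end ViewTree

section Rewriting

open VOTree

variable {R : Type u} {V : Type v} [DecidableEq V] {σ : Signature R}

/-- The trees of a variable order are subtrees below the empty path. -/
theorem IsVO.isSubVO {Q : CQ σ V} {ω : List (VOTree σ V)} (h : IsVO Q ω) {t : VOTree σ V}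
    (ht : t ∈ ω) : IsSubVO Q t ∅ none := by
  classical
  obtain ⟨hv, ha, hp⟩ := h
  have hperm := List.perm_cons_erase ht
  have hsum : t.vars + ((ω.erase t).map vars).sum = Q.vars.val := by
    rw [← hv, (hperm.map vars).sum_eq]
    simp
  have hnd : (t.vars + ((ω.erase t).map vars).sum).Nodup := hsum ▸ Q.vars.nodup
  refine ⟨hp t ht, fun A hA => ?_, fun X hX => ?_, ?_, (Multiset.nodup_add.1 hnd).1, by simp⟩
  · rw [← Finset.mem_val, ← ha, List.mem_map_sum_multiset]
    exact ⟨t, ht, hA⟩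
  · rw [← Finset.mem_val, ← hv, List.mem_map_sum_multiset]
    exact ⟨t, ht, hX⟩
  · intro A hA Z hZA hZ
    rw [← Finset.mem_val, ← ha, List.mem_map_sum_multiset] at hA
    obtain ⟨t', ht', hA'⟩ := hA
    by_cases htt : t' = t
    · exact htt ▸ hA'
    · exfalso
      have h1 : Z ∈ t'.vars := by
        simpa using (hp t' ht').vars_subset hA' hZA
      exact Multiset.disjoint_left.1 (Multiset.nodup_add.1 hnd).2.2 hZ
        (List.mem_map_sum_multiset.2 ⟨t', (List.mem_erase_of_ne htt).2 ht', h1⟩)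

/-! ### The view trees of a variable order -/

theorem leaves_buildViewTree (Q : CQ σ V) (t : VOTree σ V) (anc : Finset V) :
    (buildViewTree Q t anc).leaves = t.atoms := by
  induction t generalizing anc with
  | atom A => rfl
  | var X k c ih => simp [buildViewTree, ViewTree.leaves, atoms, ih]

/-- A variable of an atom below a child of `X` that is `X` or an ancestor of `X` belongs to the
schema of the view of this child. -/
theorem VOTree.IsSubVO.mem_schema_of_mem_atoms {Q : CQ σ V} {t : VOTree σ V} {anc : Finset V}
    {par : Option V} (h : IsSubVO Q t anc par) {A : QAtom σ V} (hA : A ∈ t.atoms) {Z : V}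
    (hZ : Z ∈ A.vars) (hanc : Z ∈ anc) : Z ∈ (buildViewTree Q t anc).schema := by
  cases t with
  | atom B =>
    simp only [atoms, Multiset.mem_singleton] at hA
    subst hA
    exact hZ
  | var X k c =>
    obtain ⟨W, h1, h2⟩ := h.placed.exists_mem_vars hA
    exact mem_dep.2 ⟨hanc, A, h.atoms_mem A hA, hZ, W, h2, h1⟩

theorem VOTree.IsSubVO.schema_subset {Q : CQ σ V} {t : VOTree σ V} {anc : Finset V}
    {par : Option V} (h : IsSubVO Q t anc par) : (buildViewTree Q t anc).schema ⊆ anc := by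
  cases t with
  | atom B => exact h.placed.1
  | var X k c => exact fun Y hY => (mem_dep.1 hY).1

/-- The atoms below `X` cover the schema of the join view `V_X`. -/
theorem VOTree.IsSubVO.exists_atom {Q : CQ σ V} {X : V} {k : ℕ} {c : Fin k → VOTree σ V}
    {anc : Finset V} {par : Option V} (h : IsSubVO Q (var X k c) anc par) {Y : V}
    (hY : Y ∈ insert X (dep Q (var X k c) anc)) :
    ∃ A ∈ (var X k c).atoms, Y ∈ A.vars := by
  rcases Finset.mem_insert.1 hY with rfl | hY
  · obtain ⟨A, hA, hYA⟩ := Finset.mem_biUnion.1 (h.vars_mem Y (mem_vars_var.2 (Or.inl rfl)))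
    exact ⟨A, h.closed A hA Y hYA (mem_vars_var.2 (Or.inl rfl)), hYA⟩
  · obtain ⟨-, A, hA, hYA, Z, hZ, hZA⟩ := mem_dep.1 hY
    exact ⟨A, h.closed A hA Z hZA hZ, hYA⟩

/-- The schema of the join view `V_X` is the union of the schemas of its children. -/
theorem VOTree.IsSubVO.insert_dep_eq {Q : CQ σ V} {X : V} {k : ℕ} {c : Fin k → VOTree σ V}
    {anc : Finset V} {par : Option V} (h : IsSubVO Q (var X k c) anc par) :
    insert X (dep Q (var X k c) anc) =
      Finset.univ.biUnion fun i => (buildViewTree Q (c i) (insert X anc)).schema := by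
  ext Y
  simp only [Finset.mem_biUnion, Finset.mem_univ, true_and]
  constructor
  · intro hY
    obtain ⟨A, hA, hYA⟩ := h.exists_atom hY
    obtain ⟨i, hi⟩ := mem_atoms_var.1 hA
    refine ⟨i, (h.child i).mem_schema_of_mem_atoms hi hYA ?_⟩
    rcases Finset.mem_insert.1 hY with rfl | hY
    · exact Finset.mem_insert_self _ _
    · exact Finset.mem_insert_of_mem (mem_dep.1 hY).1
  · rintro ⟨i, hi⟩
    rcases Finset.mem_insert.1 ((h.child i).schema_subset hi) with rfl | hanc
    · exact Finset.mem_insert_self _ _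
    · refine Finset.mem_insert_of_mem (mem_dep.2 ⟨hanc, ?_⟩)
      have hp := h.placed i
      have hc := h.child i
      have hmem : ∀ Z ∈ (c i).vars, Z ∈ (var X k c).vars := fun Z hZ =>
        mem_vars_var.2 (Or.inr ⟨i, hZ⟩)
      cases hci : c i with
      | atom B =>
        rw [hci] at hi hp hc
        exact ⟨B, hc.atoms_mem B (by simp [atoms]), hi, X, mem_vars_var.2 (Or.inl rfl),
          hp.2 X rfl⟩
      | var W l d =>
        rw [hci] at hi hmem
        obtain ⟨-, A, hA, hYA, Z, hZ, hZA⟩ := mem_dep.1 hi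
        exact ⟨A, hA, hYA, Z, hmem Z hZ, hZA⟩

theorem VOTree.IsSubVO.wellFormed {Q : CQ σ V} {t : VOTree σ V} {anc : Finset V}
    {par : Option V} (h : IsSubVO Q t anc par) : (buildViewTree Q t anc).WellFormed := by
  induction t generalizing anc par with
  | atom A => trivial
  | var X k c ih =>
    exact ⟨Finset.subset_insert _ _, h.insert_dep_eq, fun i => ih i (h.child i)⟩

namespace ViewTree

theorem WellFormed.schema_subset {T : ViewTree σ V} (h : T.WellFormed) {Y : V}
    (hY : Y ∈ T.schema) : ∃ A ∈ T.leaves, Y ∈ A.vars := by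
  induction T with
  | atom A => exact ⟨A, by simp [leaves], hY⟩
  | join S k c ih =>
    obtain ⟨hS, hc⟩ := h
    simp only [schema, hS, Finset.mem_biUnion, Finset.mem_univ, true_and] at hY
    obtain ⟨i, hi⟩ := hY
    obtain ⟨A, hA, hYA⟩ := ih i (hc i) hi
    exact ⟨A, by simpa [leaves, Multiset.mem_sum] using ⟨i, hA⟩, hYA⟩
  | proj S c ih => exact ih h.2 (h.1 hY)

theorem WellFormed.isNode {T S : ViewTree σ V} (h : T.WellFormed) (hS : S.IsNode T) :
    S.WellFormed ∧ ∀ A ∈ S.leaves, A ∈ T.leaves := by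
  induction T with
  | atom A => rw [hS.eq_of_atom]; exact ⟨h, fun _ => id⟩
  | join F k c ih =>
    rcases hS.cases_join with rfl | ⟨i, hi⟩
    · exact ⟨h, fun _ => id⟩
    · obtain ⟨h1, h2⟩ := ih i (h.2 i) hi
      refine ⟨h1, fun A hA => ?_⟩
      simp only [leaves, Multiset.mem_sum]
      exact ⟨i, Finset.mem_univ _, h2 A hA⟩
  | proj F c ih =>
    rcases hS.cases_proj with rfl | hi
    · exact ⟨h, fun _ => id⟩
    · exact ih h.2 hi

end ViewTree

open ViewTree

/-! ### Safety of the rewriting -/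

theorem IsVO.exists_tree {Q : CQ σ V} {ω : List (VOTree σ V)} (h : IsVO Q ω) {A : QAtom σ V}
    (hA : A ∈ Q.body) : ∃ t ∈ ω, A ∈ t.atoms := by
  rw [← Finset.mem_val, ← h.2.1, List.mem_map_sum_multiset] at hA
  exact hA

/-- All atoms that contain a variable projected away by a view are below this view. -/
theorem VOTree.IsSubVO.mem_leaves_of_proj {Q : CQ σ V} {t : VOTree σ V} {anc : Finset V}
    {par : Option V} (h : IsSubVO Q t anc par) {S : Finset V} {c : ViewTree σ V}
    (hn : (ViewTree.proj S c).IsNode (buildViewTree Q t anc)) {X : V} (hX : X ∈ c.schema \ S)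
    {A : QAtom σ V} (hA : A ∈ Q.body) (hXA : X ∈ A.vars) : A ∈ c.leaves := by
  induction t generalizing anc par with
  | atom B => cases hn.eq_of_atom
  | var Y k d ih =>
    rcases hn.cases_proj with h1 | h1
    · obtain ⟨rfl, rfl⟩ := ViewTree.proj.inj h1
      have hXY : X = Y := by
        rw [Finset.mem_sdiff] at hX
        exact (Finset.mem_insert.1 hX.1).resolve_right hX.2
      subst hXY
      have := h.closed A hA X hXA (mem_vars_var.2 (Or.inl rfl))
      rwa [← leaves_buildViewTree Q _ anc] at this
    · rcases h1.cases_join with h2 | ⟨i, hi⟩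
      · cases h2
      · exact ih i (h.child i) hi

theorem correctnessProperty_rewriteVO {Q : CQ σ V} {ω : List (VOTree σ V)} (h : IsVO Q ω) :
    CorrectnessProperty Q (rewriteVO Q ω) := by
  constructor
  · intro A hA
    obtain ⟨t, ht, hAt⟩ := h.exists_tree hA
    refine ⟨_, List.mem_map_of_mem ht, fun B _ hAB => ?_⟩
    rw [leaves_buildViewTree]
    unfold CQ.SameComponent at hAB
    induction hAB with
    | refl => exact hAt
    | tail _ hBC ih =>
      obtain ⟨hB, hC, hd⟩ := hBC
      obtain ⟨Z, hZB, hZC⟩ := Finset.not_disjoint_iff.1 hd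
      have hs := h.isSubVO ht
      have : Z ∈ t.vars := by simpa using hs.placed.vars_subset (ih hB) hZB
      exact hs.closed _ hC Z hZC this
  · intro T hT S c hn X hX A hA hXA
    obtain ⟨t, ht, rfl⟩ := List.mem_map.1 hT
    exact (h.isSubVO ht).mem_leaves_of_proj hn hX hA hXA

/-- In a canonical variable order, a dynamic atom below a child of `X` contains `X` and all
ancestors of `X`, so the schema of the view of this child is as large as a child of the view `V_X`
can have. -/
theorem VOTree.IsSubVO.update {Q : CQ σ V} {t : VOTree σ V} {anc : Finset V}
    {par : Option V} (h : IsSubVO Q t anc par) (hc : t.Canonical anc) {U S S' : ViewTree σ V}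
    (hU : U.IsNode (buildViewTree Q t anc)) {i j : ℕ} (hij : i ≠ j) (hS : U.child i = some S)
    (hS' : U.child j = some S') (hd : S.IsDynamic) : S'.schema ⊆ S.schema := by
  induction t generalizing anc par with
  | atom B =>
    have : U = .atom B := hU.eq_of_atom
    subst this
    simp [ViewTree.child] at hS
  | var X k c ih =>
    rcases hU.cases_proj with rfl | h1
    · have h1 : i = 0 := by
        by_contra h0
        simp [ViewTree.child, h0] at hS
      have h2 : j = 0 := by
        by_contra h0
        simp [ViewTree.child, h0] at hS'
      exact absurd (h1.trans h2.symm) hij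
    · rcases h1.cases_join with rfl | ⟨l, hl⟩
      · by_cases hi : i < k
        swap
        · simp [ViewTree.child, hi] at hS
        by_cases hj : j < k
        swap
        · simp [ViewTree.child, hj] at hS'
        simp only [ViewTree.child, hi, hj, dif_pos, Option.some.injEq] at hS hS'
        subst hS hS'
        obtain ⟨A, hA, hAd⟩ := hd
        rw [leaves_buildViewTree] at hA
        intro Z hZ
        have hZ' := (h.child _).schema_subset hZ
        exact (h.child _).mem_schema_of_mem_atoms hA ((hc _).subset_vars hA hAd hZ') hZ'
      · exact ih l (h.child l) (hc l) hl

theorem updateProperty_rewriteVO {Q : CQ σ V} {ω : List (VOTree σ V)} (h : IsVO Q ω)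
    (hc : ∀ t ∈ ω, t.Canonical ∅) : UpdateProperty (rewriteVO Q ω) := by
  intro T hT p i j S S' hij hS hS' hd
  obtain ⟨t, ht, rfl⟩ := List.mem_map.1 hT
  rw [nodeAt_append] at hS hS'
  cases hU : (buildViewTree Q t ∅).nodeAt p with
  | none => simp [hU] at hS
  | some U =>
    simp only [hU, Option.bind_some, nodeAt_singleton] at hS hS'
    exact (h.isSubVO ht).update (hc t ht) ⟨p, hU⟩ hij hS hS' hd

theorem ViewTree.mem_varsAt {T : ViewTree σ V} {P : Finset (List ℕ)} {Z : V} :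
    Z ∈ T.varsAt P ↔ ∃ p ∈ P, ∃ S, T.nodeAt p = some S ∧ Z ∈ S.schema := by
  simp only [varsAt, Finset.mem_biUnion]
  refine exists_congr fun p => and_congr_right fun _ => ?_
  cases T.nodeAt p <;> simp

/-- If all ancestors of `t` are free, then the views of the free variables of `t`, together with
their children, form a subtree whose views have exactly free variables. -/
theorem VOTree.IsSubVO.exists_rootSubtree {Q : CQ σ V} {t : VOTree σ V} {anc : Finset V}
    {par : Option V} (h : IsSubVO Q t anc par) (hf : t.FreeTop Q.free anc)
    (hanc : anc ⊆ Q.free) :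
    ∃ P : Finset (List ℕ), (buildViewTree Q t anc).IsRootSubtree P ∧
      (buildViewTree Q t anc).varsAt P ⊆ Q.free ∧
      ∀ Z ∈ t.vars, Z ∈ Q.free → Z ∈ (buildViewTree Q t anc).varsAt P := by
  induction t generalizing anc par with
  | atom A =>
    refine ⟨{[]}, isRootSubtree_singleton _, ?_, by simp [VOTree.vars]⟩
    intro Z hZ
    obtain ⟨p, hp, S, hS, hZS⟩ := mem_varsAt.1 hZ
    obtain rfl := Finset.mem_singleton.1 hp
    obtain rfl := Option.some.inj hS
    exact hanc (h.placed.1 hZS)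
  | var X k c ih =>
    by_cases hX : X ∈ Q.free
    swap
    · refine ⟨{[]}, isRootSubtree_singleton _, ?_, ?_⟩
      · intro Z hZ
        obtain ⟨p, hp, S, hS, hZS⟩ := mem_varsAt.1 hZ
        obtain rfl := Finset.mem_singleton.1 hp
        obtain rfl := Option.some.inj hS
        exact hanc (h.schema_subset hZS)
      · intro Z hZ hZf
        rcases mem_vars_var.1 hZ with rfl | ⟨i, hi⟩
        · exact absurd hZf hX
        · exact absurd hZf ((hf.2 i).notMem
            (fun h' => hX (h' (Finset.mem_insert_self _ _))) hi)
    have hanc' : insert X anc ⊆ Q.free := Finset.insert_subset hX hanc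
    choose P hP1 hP2 hP3 using fun i => ih i (h.child i) (hf.2 i) hanc'
    have hnode : ∀ (i : Fin k) (q : List ℕ), (buildViewTree Q (.var X k c) anc).nodeAt
        (0 :: (i : ℕ) :: q) = (buildViewTree Q (c i) (insert X anc)).nodeAt q := by
      intro i q
      simp [buildViewTree, nodeAt, ViewTree.child]
    let P' : Finset (List ℕ) := {[], [0]} ∪ Finset.univ.biUnion fun i : Fin k =>
      (P i).image fun q => 0 :: (i : ℕ) :: q
    have hP' : ∀ p, p ∈ P' ↔ p = [] ∨ p = [0] ∨ ∃ i : Fin k, ∃ q ∈ P i, 0 :: (i : ℕ) :: q = p := by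
      intro p
      simp [P']
    refine ⟨P', ⟨by simp [P'], ?_, ?_⟩, ?_, ?_⟩
    · intro p i hp
      rw [hP'] at hp ⊢
      rcases hp with hp | hp | ⟨l, q, hq, hp⟩
      · simp at hp
      · rcases p with _ | ⟨a, p⟩
        · exact Or.inl rfl
        · simp at hp
      · rcases p with _ | ⟨a, _ | ⟨b, p⟩⟩
        · exact Or.inl rfl
        · simp only [List.cons_append, List.nil_append, List.cons.injEq] at hp
          exact Or.inr (Or.inl (by rw [hp.1]))
        · simp only [List.cons_append, List.cons.injEq] at hp
          obtain ⟨rfl, rfl, rfl⟩ := hp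
          exact Or.inr (Or.inr ⟨l, p, (hP1 l).2.1 p i hq, rfl⟩)
    · intro p hp
      rcases (hP' p).1 hp with rfl | rfl | ⟨l, q, hq, rfl⟩
      · rfl
      · rfl
      · rw [hnode]
        exact (hP1 l).2.2 q hq
    · intro Z hZ
      obtain ⟨p, hp, S, hS, hZS⟩ := mem_varsAt.1 hZ
      rcases (hP' p).1 hp with rfl | rfl | ⟨l, q, hq, rfl⟩
      · obtain rfl := Option.some.inj hS
        exact hanc (h.schema_subset hZS)
      · obtain rfl := Option.some.inj hS
        rcases Finset.mem_insert.1 hZS with rfl | h1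
        · exact hX
        · exact hanc (mem_dep.1 h1).1
      · rw [hnode] at hS
        exact hP2 l (mem_varsAt.2 ⟨q, hq, S, hS, hZS⟩)
    · intro Z hZ hZf
      rw [mem_varsAt]
      rcases mem_vars_var.1 hZ with rfl | ⟨i, hi⟩
      · exact ⟨[0], (hP' _).2 (Or.inr (Or.inl rfl)), _, rfl, Finset.mem_insert_self _ _⟩
      · obtain ⟨q, hq, S, hS, hZS⟩ := mem_varsAt.1 (hP3 i Z hi hZf)
        exact ⟨0 :: (i : ℕ) :: q, (hP' _).2 (Or.inr (Or.inr ⟨i, q, hq, rfl⟩)), S,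
          (hnode i q).trans hS, hZS⟩

theorem enumerationProperty_rewriteVO {Q : CQ σ V} {ω : List (VOTree σ V)} (h : IsVO Q ω)
    (hf : ∀ t ∈ ω, t.FreeTop Q.free ∅) : EnumerationProperty Q (rewriteVO Q ω) := by
  intro T hT
  obtain ⟨t, ht, rfl⟩ := List.mem_map.1 hT
  have hs := h.isSubVO ht
  obtain ⟨P, h1, h2, h3⟩ := hs.exists_rootSubtree (hf t ht) (by simp)
  refine ⟨P, h1, Finset.Subset.antisymm (fun Z hZ => ?_) fun Z hZ => ?_⟩
  · refine Finset.mem_inter.2 ⟨h2 hZ, ?_⟩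
    obtain ⟨p, hp, S, hS, hZS⟩ := mem_varsAt.1 hZ
    obtain ⟨hw, hl⟩ := hs.wellFormed.isNode ⟨p, hS⟩
    obtain ⟨A, hA, hZA⟩ := hw.schema_subset hZS
    exact Finset.mem_biUnion.2 ⟨A, Multiset.mem_toFinset.2 (hl A hA), hZA⟩
  · obtain ⟨hZf, hZ⟩ := Finset.mem_inter.1 hZ
    obtain ⟨A, hA, hZA⟩ := Finset.mem_biUnion.1 hZ
    rw [Multiset.mem_toFinset, leaves_buildViewTree] at hA
    exact h3 Z (by simpa using hs.placed.vars_subset hA hZA) hZf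

theorem isSafeRewriting_rewriteVO {Q : CQ σ V} {ω : List (VOTree σ V)}
    (h : IsWellStructuredVO Q ω) : IsSafeRewriting Q (rewriteVO Q ω) where
  isRewriting := by
    refine ⟨fun T hT => ?_, ?_⟩
    · obtain ⟨t, ht, rfl⟩ := List.mem_map.1 hT
      exact (h.1.isSubVO ht).wellFormed
    · rw [← h.1.2.1, rewriteVO, List.map_map]
      congr 1
      exact List.map_congr_left fun t _ => leaves_buildViewTree Q t ∅
  correctness := correctnessProperty_rewriteVO h.1
  update := updateProperty_rewriteVO h.1 h.2.1
  enumeration := enumerationProperty_rewriteVO h.1 h.2.2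

/-! ### The width of a query is attained -/

open scoped Classical in
/-- The values that a fractional edge cover number can take in the width of a variable order
for `Q`. -/
noncomputable def coverNumbers (Q : CQ σ V) : Finset ℝ≥0 :=
  insert 0 ((Q.body.powerset ×ˢ Q.vars.powerset).image fun p => fractionalCoverNumber p.1 p.2)

theorem VOTree.IsSubVO.width_mem {Q : CQ σ V} {t : VOTree σ V} {anc : Finset V}
    {par : Option V} (h : IsSubVO Q t anc par) (hanc : anc ⊆ Q.vars) :
    t.width Q anc ∈ coverNumbers Q := by
  have hsup : ∀ a ∈ coverNumbers Q, ∀ b ∈ coverNumbers Q, a ⊔ b ∈ coverNumbers Q := by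
    intro a ha b hb
    rcases max_choice a b with h | h <;> rw [h] <;> assumption
  induction t generalizing anc par with
  | atom A => exact Finset.mem_insert_self _ _
  | var X k c ih =>
    have hX : X ∈ Q.vars := h.vars_mem X (mem_vars_var.2 (Or.inl rfl))
    refine hsup _ ?_ _ (Finset.sup_mem (coverNumbers Q : Set ℝ≥0) (Finset.mem_insert_self _ _) hsup
      Finset.univ _ fun i _ => ih i (h.child i) (Finset.insert_subset hX hanc))
    refine Finset.mem_insert_of_mem (Finset.mem_image.2 ⟨(_, _), ?_, rfl⟩)
    rw [Finset.mem_product, Finset.mem_powerset, Finset.mem_powerset]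
    exact ⟨fun A hA => h.atoms_mem A (Multiset.mem_toFinset.1 hA),
      Finset.insert_subset hX fun Y hY => hanc (mem_dep.1 hY).1⟩

theorem voWidth_mem {Q : CQ σ V} {ω : List (VOTree σ V)} (h : IsVO Q ω) :
    voWidth Q ω ∈ coverNumbers Q := by
  have key : ∀ l : List (VOTree σ V), l ⊆ ω → voWidth Q l ∈ coverNumbers Q := by
    intro l
    induction l with
    | nil => exact fun _ => Finset.mem_insert_self _ _
    | cons t l ih =>
      intro hl
      have h1 := (h.isSubVO (hl List.mem_cons_self)).width_mem (by simp)
      have h2 := ih fun x hx => hl (List.mem_cons_of_mem _ hx)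
      change max (t.width Q ∅) (voWidth Q l) ∈ _
      rcases max_choice (t.width Q ∅) (voWidth Q l) with h | h <;> rw [h] <;> assumption
  exact key ω fun _ => id

/-- The width of a query is a minimum, since the widths of its variable orders take only finitely
many values. -/
theorem exists_voWidth_eq {Q : CQ σ V} {ω : List (VOTree σ V)} (h : IsWellStructuredVO Q ω) :
    ∃ ω₀, IsWellStructuredVO Q ω₀ ∧ voWidth Q ω₀ = preprocessingWidth Q := by
  have hfin : {w | ∃ ω, IsWellStructuredVO Q ω ∧ w = voWidth Q ω}.Finite := by
    refine (coverNumbers Q).finite_toSet.subset ?_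
    rintro w ⟨ω', h', rfl⟩
    exact voWidth_mem h'.1
  have hne : {w | ∃ ω, IsWellStructuredVO Q ω ∧ w = voWidth Q ω}.Nonempty := ⟨_, ω, h, rfl⟩
  obtain ⟨ω₀, h1, h2⟩ := hne.csInf_mem hfin
  exact ⟨ω₀, h1, h2.symm⟩

end Rewriting

/-! ### The size of a join in terms of fractional edge covers -/

section EdgeCover

/-- A form of Hölder's inequality: the families in `E'` are bounded in sum and have total weight at
least one, the other families are only bounded pointwise. -/
theorem sum_prod_rpow_le_prod_rpow {ι κ : Type*} {E E' : Finset ι} (hE' : E' ⊆ E) (T : Finset κ)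
    {a : ι → κ → ℝ} {S : ι → ℝ} {lam : ι → ℝ} (hlam : ∀ i, 0 ≤ lam i)
    (ha : ∀ i j, 0 ≤ a i j) (hS : ∀ i, 0 ≤ S i) (haS : ∀ i ∈ E, ∀ j ∈ T, a i j ≤ S i)
    (hsum : ∀ i ∈ E', ∑ j ∈ T, a i j ≤ S i) (h1 : 1 ≤ ∑ i ∈ E', lam i) :
    ∑ j ∈ T, ∏ i ∈ E, a i j ^ lam i ≤ ∏ i ∈ E, S i ^ lam i := by
  set L := ∑ i ∈ E', lam i with hL
  have hL0 : 0 < L := lt_of_lt_of_le one_pos h1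
  -- It suffices to bound the ratios `a i j / S i`, which lie in the unit interval.
  have hr0 : ∀ i j, 0 ≤ a i j / S i := fun i j => div_nonneg (ha i j) (hS i)
  have hr1 : ∀ i ∈ E, ∀ j ∈ T, a i j / S i ≤ 1 := fun i hi j hj =>
    div_le_one_of_le₀ (haS i hi j hj) (hS i)
  have hmul : ∀ i ∈ E, ∀ j ∈ T, a i j ^ lam i = (a i j / S i) ^ lam i * S i ^ lam i := by
    intro i hi j hj
    rw [← Real.mul_rpow (hr0 i j) (hS i)]
    congr 1
    rcases eq_or_ne (S i) 0 with h0 | h0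
    · have := haS i hi j hj
      rw [h0] at this ⊢
      simpa using le_antisymm this (ha i j)
    · rw [div_mul_cancel₀ _ h0]
  have hw1 : ∑ i ∈ E', lam i / L = 1 := by
    rw [← Finset.sum_div, div_self hL0.ne']
  have hratio : ∀ j ∈ T, ∏ i ∈ E, (a i j / S i) ^ lam i ≤ ∑ i ∈ E', lam i / L * (a i j / S i) := by
    intro j hj
    calc ∏ i ∈ E, (a i j / S i) ^ lam i
        ≤ ∏ i ∈ E', (a i j / S i) ^ lam i := by
          classical
          rw [← Finset.prod_sdiff hE']
          refine mul_le_of_le_one_left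
            (Finset.prod_nonneg fun i _ => Real.rpow_nonneg (hr0 i j) _) ?_
          exact Finset.prod_le_one (fun i _ => Real.rpow_nonneg (hr0 i j) _) fun i hi =>
            Real.rpow_le_one (hr0 i j) (hr1 i (Finset.sdiff_subset hi) j hj) (hlam i)
      _ ≤ ∏ i ∈ E', (a i j / S i) ^ (lam i / L) := by
          refine Finset.prod_le_prod (fun i _ => Real.rpow_nonneg (hr0 i j) _) fun i hi => ?_
          exact Real.rpow_le_rpow_of_exponent_ge' (hr0 i j) (hr1 i (hE' hi) j hj)
            (div_nonneg (hlam i) hL0.le) (div_le_self (hlam i) h1)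
      _ ≤ _ := Real.geom_mean_le_arith_mean_weighted E' _ _
          (fun i _ => div_nonneg (hlam i) hL0.le) hw1 fun i _ => hr0 i j
  calc ∑ j ∈ T, ∏ i ∈ E, a i j ^ lam i
      = (∑ j ∈ T, ∏ i ∈ E, (a i j / S i) ^ lam i) * ∏ i ∈ E, S i ^ lam i := by
        rw [Finset.sum_mul]
        refine Finset.sum_congr rfl fun j hj => ?_
        rw [← Finset.prod_mul_distrib]
        exact Finset.prod_congr rfl fun i hi => hmul i hi j hj
    _ ≤ 1 * ∏ i ∈ E, S i ^ lam i := by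
        refine mul_le_mul_of_nonneg_right ?_
          (Finset.prod_nonneg fun i _ => Real.rpow_nonneg (hS i) _)
        calc ∑ j ∈ T, ∏ i ∈ E, (a i j / S i) ^ lam i
            ≤ ∑ j ∈ T, ∑ i ∈ E', lam i / L * (a i j / S i) := Finset.sum_le_sum hratio
          _ = ∑ i ∈ E', lam i / L * ((∑ j ∈ T, a i j) / S i) := by
              rw [Finset.sum_comm]
              simp_rw [← Finset.mul_sum, Finset.sum_div]
          _ ≤ ∑ i ∈ E', lam i / L := by
              refine Finset.sum_le_sum fun i hi => ?_
              refine mul_le_of_le_one_right (div_nonneg (hlam i) hL0.le) ?_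
              exact div_le_one_of_le₀ (hsum i hi) (hS i)
          _ = 1 := hw1
    _ = _ := one_mul _

variable {V : Type v} {Dom : Type x}

open scoped Classical in
/-- The number of tuples of the relation `T` with columns `args` that agree on the common columns
with the tuple `t` with columns `bs`. -/
noncomputable def matchCount (T : Finset (List Dom)) (args bs : List V) (t : List Dom) : ℕ :=
  (T.filter fun u => ∃ b : V → Dom, args.map b = u ∧ bs.map b = t).card

theorem matchCount_le_card (T : Finset (List Dom)) (args bs : List V) (t : List Dom) :
    matchCount T args bs t ≤ T.card := by
  classical
  exact Finset.card_filter_le _ _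

theorem matchCount_cons_le (T : Finset (List Dom)) (args bs : List V) (X : V) (t : List Dom) :
    matchCount T args (X :: bs) t ≤ matchCount T args bs t.tail := by
  classical
  refine Finset.card_le_card fun u hu => ?_
  obtain ⟨huT, b, h1, rfl⟩ := Finset.mem_filter.1 hu
  exact Finset.mem_filter.2 ⟨huT, b, h1, rfl⟩

/-- The matches of `t` in a relation that has the column `X` are distributed over the extensions of
`t` by a value of `X`. -/
theorem sum_matchCount_cons_le (T : Finset (List Dom)) {args : List V} (bs : List V) {X : V}
    (hX : X ∈ args) (t : List Dom) (T' : Finset (List Dom)) (hT' : ∀ t' ∈ T', t'.tail = t) :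
    ∑ t' ∈ T', matchCount T args (X :: bs) t' ≤ matchCount T args bs t := by
  classical
  unfold matchCount
  rw [← Finset.card_biUnion]
  · refine Finset.card_le_card fun u hu => ?_
    obtain ⟨t', ht', hu⟩ := Finset.mem_biUnion.1 hu
    obtain ⟨huT, b, h1, h2⟩ := Finset.mem_filter.1 hu
    refine Finset.mem_filter.2 ⟨huT, b, h1, ?_⟩
    rw [← hT' t' ht', ← h2]
    rfl
  · intro t₁ h₁ t₂ h₂ hne
    refine Finset.disjoint_left.2 fun u hu₁ hu₂ => hne ?_
    obtain ⟨-, b₁, h3, h4⟩ := Finset.mem_filter.1 hu₁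
    obtain ⟨-, b₂, h5, h6⟩ := Finset.mem_filter.1 hu₂
    have hb : b₁ X = b₂ X := List.map_inj_left.1 (h3.trans h5.symm) X hX
    have ht : bs.map b₁ = bs.map b₂ := by
      have e1 := hT' t₁ h₁
      have e2 := hT' t₂ h₂
      rw [← h4] at e1
      rw [← h6] at e2
      exact e1.trans e2.symm
    rw [← h4, ← h6, List.map_cons, List.map_cons, hb, ht]

/-- The weights `∏ᵢ (number of matches of t in the i-th relation) ^ λᵢ`, summed over tuples `t`, do
not exceed the weight of the empty tuple, since extending the tuples by one column does not
increase the sum. -/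
theorem sum_prod_matchCount_le [DecidableEq V] {ι : Type*} (E : Finset ι)
    (rel : ι → Finset (List Dom)) (args : ι → List V) (lam : ι → ℝ≥0) (bs : List V)
    (hcov : ∀ X ∈ bs, 1 ≤ ∑ i ∈ E with X ∈ args i, lam i) (T : Finset (List Dom))
    (hT : ∀ t ∈ T, t.length = bs.length) :
    ∑ t ∈ T, ∏ i ∈ E, (matchCount (rel i) (args i) bs t : ℝ) ^ (lam i : ℝ) ≤
      ∏ i ∈ E, ((rel i).card : ℝ) ^ (lam i : ℝ) := by
  classical
  induction bs generalizing T with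
  | nil =>
    have hT1 : T ⊆ {[]} := fun t ht => by simpa using hT t ht
    refine (Finset.sum_le_sum_of_subset_of_nonneg hT1 fun t _ _ =>
      Finset.prod_nonneg fun i _ => by positivity).trans ?_
    rw [Finset.sum_singleton]
    refine Finset.prod_le_prod (fun i _ => by positivity) fun i _ => ?_
    exact Real.rpow_le_rpow (by positivity) (Nat.cast_le.2 (matchCount_le_card _ _ _ _))
      (lam i).2
  | cons X bs ih =>
    have ih' := ih (fun Y hY => hcov Y (List.mem_cons_of_mem _ hY)) (T.image List.tail) (by
      intro t ht
      obtain ⟨t', ht', rfl⟩ := Finset.mem_image.1 ht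
      simp [hT t' ht'])
    refine le_trans ?_ ih'
    rw [← Finset.sum_fiberwise_of_maps_to (g := List.tail) (t := T.image List.tail)
      fun t ht => Finset.mem_image_of_mem _ ht]
    refine Finset.sum_le_sum fun t _ => ?_
    refine sum_prod_rpow_le_prod_rpow (E' := E.filter fun i => X ∈ args i)
      (Finset.filter_subset _ _) _ (a := fun i t' => (matchCount (rel i) (args i) (X :: bs) t' : ℝ))
      (S := fun i => (matchCount (rel i) (args i) bs t : ℝ)) (fun i => (lam i).2)
      (fun i _ => by positivity) (fun i => by positivity) ?_ ?_ ?_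
    · intro i _ t' ht'
      rw [← (Finset.mem_filter.1 ht').2]
      exact Nat.cast_le.2 (matchCount_cons_le _ _ _ _ _)
    · intro i hi
      exact_mod_cast sum_matchCount_cons_le (rel i) bs (Finset.mem_filter.1 hi).2 t _
        fun t' ht' => (Finset.mem_filter.1 ht').2
    · exact_mod_cast hcov X List.mem_cons_self

variable {R : Type u} [DecidableEq V] {σ : Signature R}

/-- If every weight function that covers `F` bounds a sum in terms of products of powers, then the
fractional edge cover number of `F` bounds the sum. -/
theorem sum_le_rpow_fractionalCoverNumber {E : Finset (QAtom σ V)} {F : Finset V}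
    (hcov : ∀ X ∈ F, ∃ A ∈ E, X ∈ A.vars) (rel : QAtom σ V → Finset (List Dom)) {M : ℕ}
    (hM : 1 ≤ M) (hrel : ∀ A ∈ E, (rel A).card ≤ M) {bs : List V} (hbs : ∀ X ∈ bs, X ∈ F)
    (T : Finset (List Dom)) (hT : ∀ t ∈ T, t.length = bs.length) (f : List Dom → ℝ)
    (hf : ∀ t ∈ T, ∀ lam : QAtom σ V → ℝ≥0, (∀ X ∈ F, 1 ≤ ∑ A ∈ E with X ∈ A.vars, lam A) →
      f t ≤ ∏ A ∈ E, (matchCount (rel A) A.args bs t : ℝ) ^ (lam A : ℝ)) :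
    ∑ t ∈ T, f t ≤ (M : ℝ) ^ (fractionalCoverNumber E F : ℝ) := by
  set C := {c : ℝ≥0 | ∃ lam : QAtom σ V → ℝ≥0, (∀ A ∈ E, lam A ≤ 1) ∧
    (∀ X ∈ F, 1 ≤ ∑ A ∈ E with X ∈ A.vars, lam A) ∧ c = ∑ A ∈ E, lam A} with hC
  have hM1 : (1 : ℝ) ≤ M := by exact_mod_cast hM
  have hmem : fractionalCoverNumber E F ∈ closure C := by
    refine csInf_mem_closure ?_ (OrderBot.bddBelow _)
    refine ⟨_, fun _ => 1, fun _ _ => le_rfl, fun X hX => ?_, rfl⟩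
    obtain ⟨A, hA, hXA⟩ := hcov X hX
    exact Finset.single_le_sum (f := fun _ => (1 : ℝ≥0)) (fun _ _ => zero_le_one)
      (Finset.mem_filter.2 ⟨hA, hXA⟩)
  have hclosed : IsClosed {c : ℝ≥0 | ∑ t ∈ T, f t ≤ (M : ℝ) ^ (c : ℝ)} := by
    refine isClosed_le continuous_const ?_
    exact (Real.continuous_const_rpow (by positivity)).comp NNReal.continuous_coe
  refine closure_minimal ?_ hclosed hmem
  rintro c ⟨lam, -, hlam, rfl⟩
  calc ∑ t ∈ T, f t
      ≤ ∑ t ∈ T, ∏ A ∈ E, (matchCount (rel A) A.args bs t : ℝ) ^ (lam A : ℝ) :=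
        Finset.sum_le_sum fun t ht => hf t ht lam hlam
    _ ≤ ∏ A ∈ E, ((rel A).card : ℝ) ^ (lam A : ℝ) := by
        refine sum_prod_matchCount_le E rel QAtom.args lam bs (fun X hX => ?_) T hT
        simpa [QAtom.vars] using hlam X (hbs X hX)
    _ ≤ ∏ A ∈ E, (M : ℝ) ^ (lam A : ℝ) := by
        refine Finset.prod_le_prod (fun A _ => by positivity) fun A hA => ?_
        exact Real.rpow_le_rpow (by positivity) (by exact_mod_cast hrel A hA) (lam A).2
    _ = (M : ℝ) ^ ((∑ A ∈ E, lam A : ℝ≥0) : ℝ) := by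
        rw [NNReal.coe_sum, Real.rpow_sum_of_pos (by positivity)]

/-- The join of the relations, projected to the columns `bs`, has size at most `M ^ ρ*`. -/
theorem card_le_rpow_fractionalCoverNumber {E : Finset (QAtom σ V)} {F : Finset V}
    (hcov : ∀ X ∈ F, ∃ A ∈ E, X ∈ A.vars) (rel : QAtom σ V → Finset (List Dom)) {M : ℕ}
    (hM : 1 ≤ M) (hrel : ∀ A ∈ E, (rel A).card ≤ M) {bs : List V} (hbs : ∀ X ∈ bs, X ∈ F)
    (T : Finset (List Dom)) (hT : ∀ t ∈ T, t.length = bs.length)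
    (hpos : ∀ t ∈ T, ∀ A ∈ E, 1 ≤ matchCount (rel A) A.args bs t) :
    (T.card : ℝ) ≤ (M : ℝ) ^ (fractionalCoverNumber E F : ℝ) := by
  have := sum_le_rpow_fractionalCoverNumber hcov rel hM hrel hbs T hT (fun _ => 1)
    fun t ht lam _ => Finset.one_le_prod fun A hA =>
      Real.one_le_rpow (by exact_mod_cast hpos t ht A hA) (lam A).2
  simpa using this

/-- Enumerating, for each tuple `t` of the join over the columns `bs`, the candidates for the column
`X` from an atom with fewest matches of `t` takes time `M ^ ρ*`. -/
theorem sum_min_le_rpow_fractionalCoverNumber {E : Finset (QAtom σ V)} {F : Finset V}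
    (hcov : ∀ X ∈ F, ∃ A ∈ E, X ∈ A.vars) (rel : QAtom σ V → Finset (List Dom)) {M : ℕ}
    (hM : 1 ≤ M) (hrel : ∀ A ∈ E, (rel A).card ≤ M) {bs : List V} (hbs : ∀ X ∈ bs, X ∈ F)
    (T : Finset (List Dom)) (hT : ∀ t ∈ T, t.length = bs.length)
    (hpos : ∀ t ∈ T, ∀ A ∈ E, 1 ≤ matchCount (rel A) A.args bs t) {X : V} (hX : X ∈ F)
    (m : List Dom → ℕ)
    (hm : ∀ t ∈ T, ∀ A ∈ E, X ∈ A.vars → m t ≤ matchCount (rel A) A.args bs t) :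
    ∑ t ∈ T, (m t : ℝ) ≤ (M : ℝ) ^ (fractionalCoverNumber E F : ℝ) := by
  refine sum_le_rpow_fractionalCoverNumber hcov rel hM hrel hbs T hT _ fun t ht lam hlam => ?_
  have hone : ∀ A ∈ E, (1 : ℝ) ≤ (matchCount (rel A) A.args bs t : ℝ) ^ (lam A : ℝ) := fun A hA =>
    Real.one_le_rpow (by exact_mod_cast hpos t ht A hA) (lam A).2
  rcases Nat.eq_zero_or_pos (m t) with h0 | h0
  · rw [h0, Nat.cast_zero]
    exact zero_le_one.trans (Finset.one_le_prod hone)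
  have hm1 : (1 : ℝ) ≤ m t := by exact_mod_cast h0
  calc (m t : ℝ) = (m t : ℝ) ^ (1 : ℝ) := (Real.rpow_one _).symm
    _ ≤ (m t : ℝ) ^ ((∑ A ∈ E with X ∈ A.vars, lam A : ℝ≥0) : ℝ) :=
        Real.rpow_le_rpow_of_exponent_le hm1 (by exact_mod_cast hlam X hX)
    _ = ∏ A ∈ E with X ∈ A.vars, (m t : ℝ) ^ (lam A : ℝ) := by
        rw [NNReal.coe_sum, Real.rpow_sum_of_pos (by positivity)]
    _ ≤ ∏ A ∈ E with X ∈ A.vars, (matchCount (rel A) A.args bs t : ℝ) ^ (lam A : ℝ) := by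
        refine Finset.prod_le_prod (fun A _ => by positivity) fun A hA => ?_
        obtain ⟨hA, hXA⟩ := Finset.mem_filter.1 hA
        exact Real.rpow_le_rpow (by positivity) (by exact_mod_cast hm t ht A hA hXA) (lam A).2
    _ ≤ ∏ A ∈ E, (matchCount (rel A) A.args bs t : ℝ) ^ (lam A : ℝ) :=
        Finset.prod_le_prod_of_subset_of_one_le (Finset.filter_subset _ _)
          (fun A _ => by positivity) (fun A hA _ => hone A hA)

end EdgeCover

/-! ### Reasoning about programs -/

namespace PState

variable {ν Dom : Type*}

/-- The relations stored in `s'` contain those stored in `s`. -/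
def Le (s s' : PState ν Dom) : Prop := ∀ r, ∀ t ∈ s.store r, t ∈ s'.store r

theorem Le.refl (s : PState ν Dom) : s.Le s := fun _ _ => id

theorem Le.trans {s₁ s₂ s₃ : PState ν Dom} (h : s₁.Le s₂) (h' : s₂.Le s₃) : s₁.Le s₃ :=
  fun r t ht => h' r t (h r t ht)

/-- The stored relations have no repetitions and contain only intended tuples. -/
def Sound (Tgt : ν → List Dom → Prop) (s : PState ν Dom) : Prop :=
  ∀ r, (s.store r).Nodup ∧ ∀ t ∈ s.store r, Tgt r t

/-- The relation stored under the name `r` contains all intended tuples. -/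
def Full (Tgt : ν → List Dom → Prop) (s : PState ν Dom) (r : ν) : Prop :=
  ∀ t, Tgt r t → t ∈ s.store r

theorem Full.mono {Tgt : ν → List Dom → Prop} {s s' : PState ν Dom} {r : ν}
    (h : s.Full Tgt r) (hs : s.Le s') : s'.Full Tgt r := fun t ht => hs r t (h t ht)

end PState

namespace Prog

variable {ν Dom : Type*} [DecidableEq ν] [DecidableEq Dom]

theorem le_exec (p : Prog ν) (s : PState ν Dom) : s.Le (p.exec s).1 := by
  induction p generalizing s with
  | skip => exact PState.Le.refl s
  | seq p q hp hq => exact (hp s).trans (hq _)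
  | insert r t =>
    simp only [exec]
    split_ifs with h
    · exact PState.Le.refl s
    · intro r' t' ht'
      by_cases hr : r' = r
      · subst hr
        simp [ht']
      · simpa [Function.update_of_ne hr] using ht'
  | ifMem r t p q hp hq =>
    simp only [exec]
    split_ifs
    · exact hp s
    · exact hq s
  | ifCountLe r sel r' sel' p q hp hq =>
    simp only [exec]
    split_ifs
    · exact hp s
    · exact hq s
  | forEach r sel out p hp =>
    simp only [exec]
    generalize selected s r sel = l
    have key : ∀ (l : List (List Dom)) (acc : PState ν Dom × ℕ), s.Le acc.1 →
        s.Le (l.foldl (fun acc t =>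
          ((p.exec { acc.1 with reg := load out t acc.1.reg }).1,
            acc.2 + (p.exec { acc.1 with reg := load out t acc.1.reg }).2 + 1)) acc).1 := by
      intro l
      induction l with
      | nil => exact fun _ => id
      | cons t l ih => exact fun acc h => ih _ (PState.Le.trans h
        (hp { acc.1 with reg := load out t acc.1.reg }))
    exact key l (s, 1) (PState.Le.refl s)

/-- The rule for loops, with an invariant `I`, a property `G t` that is established in the iteration
for the tuple `t` and is preserved when relations grow, and a bound `f t` for the time of this
iteration. -/
theorem exec_forEach (I : PState ν Dom → Prop) (G : List Dom → PState ν Dom → Prop)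
    (f : List Dom → ℕ) {p : Prog ν} {r : ν} {sel : List (Option ℕ)} {out : List ℕ}
    {s : PState ν Dom} (hI : I s)
    (hbody : ∀ s' : PState ν Dom, s.Le s' → I s' → ∀ t ∈ selected s r sel,
      I (p.exec { s' with reg := load out t s'.reg }).1 ∧
      G t (p.exec { s' with reg := load out t s'.reg }).1 ∧
      (p.exec { s' with reg := load out t s'.reg }).2 ≤ f t)
    (hG : ∀ t s₁ s₂, G t s₁ → PState.Le s₁ s₂ → G t s₂) :
    I ((forEach r sel out p).exec s).1 ∧
      (∀ t ∈ selected s r sel, G t ((forEach r sel out p).exec s).1) ∧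
      ((forEach r sel out p).exec s).2 ≤ 1 + ((selected s r sel).map fun t => f t + 1).sum := by
  simp only [exec]
  have key : ∀ (l : List (List Dom)), (∀ t ∈ l, t ∈ selected s r sel) →
      ∀ acc : PState ν Dom × ℕ, s.Le acc.1 → I acc.1 →
      let res := l.foldl (fun acc t =>
        ((p.exec { acc.1 with reg := load out t acc.1.reg }).1,
          acc.2 + (p.exec { acc.1 with reg := load out t acc.1.reg }).2 + 1)) acc
      I res.1 ∧ acc.1.Le res.1 ∧ (∀ t ∈ l, G t res.1) ∧
        res.2 ≤ acc.2 + (l.map fun t => f t + 1).sum := by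
    intro l
    induction l with
    | nil => exact fun _ acc _ h => ⟨h, PState.Le.refl _, by simp, by simp⟩
    | cons t l ih =>
      intro hl acc hle hacc
      obtain ⟨h1, h2, h3⟩ := hbody acc.1 hle hacc t (hl t List.mem_cons_self)
      have hstep : acc.1.Le (p.exec { acc.1 with reg := load out t acc.1.reg }).1 :=
        le_exec p { acc.1 with reg := load out t acc.1.reg }
      obtain ⟨h4, h5, h6, h7⟩ := ih (fun t' ht' => hl t' (List.mem_cons_of_mem _ ht'))
        ((p.exec { acc.1 with reg := load out t acc.1.reg }).1,
          acc.2 + (p.exec { acc.1 with reg := load out t acc.1.reg }).2 + 1)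
        (hle.trans hstep) h1
      refine ⟨h4, hstep.trans h5, ?_, ?_⟩
      · intro t' ht'
        rcases List.mem_cons.1 ht' with rfl | ht'
        · exact hG _ _ _ h2 h5
        · exact h6 t' ht'
      · simp only [List.map_cons, List.sum_cons, List.foldl_cons]
        simp only at h7
        omega
  obtain ⟨h1, -, h2, h3⟩ := key _ (fun _ => id) (s, 1) (PState.Le.refl s) hI
  exact ⟨h1, h2, h3⟩

theorem exec_insert {Tgt : ν → List Dom → Prop} {s : PState ν Dom} (hs : s.Sound Tgt) {r : ν}
    {t : List ℕ} (ht : Tgt r (t.map s.reg)) :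
    ((insert r t).exec s).1.Sound Tgt ∧ ((insert r t).exec s).1.reg = s.reg ∧
      t.map s.reg ∈ ((insert r t).exec s).1.store r ∧ ((insert r t).exec s).2 = 1 := by
  simp only [exec]
  split_ifs with h
  · exact ⟨hs, by simp [h]⟩
  · refine ⟨fun r' => ?_, by simp⟩
    by_cases hr : r' = r
    · subst hr
      simp only [Function.update_self]
      refine ⟨List.nodup_append.2 ⟨(hs r').1, List.nodup_singleton _, ?_⟩, ?_⟩
      · intro a ha b hb
        rw [List.mem_singleton] at hb
        rintro rfl
        exact h (hb ▸ ha)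
      · intro t' ht'
        rcases List.mem_append.1 ht' with h1 | h1
        · exact (hs r').2 t' h1
        · rw [List.mem_singleton.1 h1]
          exact ht
    · simpa only [Function.update_of_ne hr] using hs r'

/-- Run `p` if every selection in the list is nonempty; the name `e` is that of an empty relation.
-/
def ifNonempty (e : ν) : List (ν × List (Option ℕ)) → Prog ν → Prog ν
  | [], p => p
  | a :: l, p => ifCountLe a.1 a.2 e [] skip (ifNonempty e l p)

theorem exec_ifNonempty {s : PState ν Dom} {e : ν} (he : s.store e = [])
    (l : List (ν × List (Option ℕ))) (p : Prog ν) :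
    ((∀ a ∈ l, selected s a.1 a.2 ≠ []) →
      (ifNonempty e l p).exec s = ((p.exec s).1, (p.exec s).2 + l.length)) ∧
    ((¬ ∀ a ∈ l, selected s a.1 a.2 ≠ []) →
      ((ifNonempty e l p).exec s).1 = s ∧ ((ifNonempty e l p).exec s).2 ≤ l.length + 1) := by
  induction l with
  | nil => simp [ifNonempty]
  | cons a l ih =>
    have h0 : selected s e [] = [] := by simp [selected, he]
    simp only [ifNonempty, exec, h0, List.length_nil, Nat.le_zero, List.length_eq_zero_iff,
      List.forall_mem_cons, List.length_cons]
    by_cases ha : selected s a.1 a.2 = []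
    · simp [ha]
    · simp only [ha, if_false, ne_eq, not_false_eq_true, true_and]
      refine ⟨fun h => ?_, fun h => ?_⟩
      · rw [ih.1 h]
        simp [add_assoc]
      · exact ⟨(ih.2 h).1, by have := (ih.2 h).2; omega⟩

/-- Run `p` if all the given relations contain the given tuples. -/
def ifAllMem : List (ν × List ℕ) → Prog ν → Prog ν
  | [], p => p
  | a :: l, p => ifMem a.1 a.2 (ifAllMem l p) skip

theorem exec_ifAllMem {s : PState ν Dom} (l : List (ν × List ℕ)) (p : Prog ν) :
    ((∀ a ∈ l, a.2.map s.reg ∈ s.store a.1) →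
      (ifAllMem l p).exec s = ((p.exec s).1, (p.exec s).2 + l.length)) ∧
    ((¬ ∀ a ∈ l, a.2.map s.reg ∈ s.store a.1) →
      ((ifAllMem l p).exec s).1 = s ∧ ((ifAllMem l p).exec s).2 ≤ l.length + 1) := by
  induction l with
  | nil => simp [ifAllMem]
  | cons a l ih =>
    simp only [ifAllMem, exec, List.forall_mem_cons, List.length_cons]
    by_cases ha : a.2.map s.reg ∈ s.store a.1
    · simp only [ha, if_true, true_and]
      refine ⟨fun h => ?_, fun h => ?_⟩
      · rw [ih.1 h]
        simp [add_assoc]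
      · exact ⟨(ih.2 h).1, by have := (ih.2 h).2; omega⟩
    · simp [ha]

/-- Run `k a` for an element `a` of `b :: l` such that the selection `sel a` from `nm a` has the
smallest number of tuples. -/
def withMin {α : Type*} (nm : α → ν) (sel : α → List (Option ℕ)) (k : α → Prog ν) :
    α → List α → Prog ν
  | b, [] => k b
  | b, a :: l => ifCountLe (nm b) (sel b) (nm a) (sel a) (withMin nm sel k b l)
      (withMin nm sel k a l)

theorem exec_withMin {α : Type*} (nm : α → ν) (sel : α → List (Option ℕ)) (k : α → Prog ν)
    (s : PState ν Dom) (b : α) (l : List α) :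
    ∃ a ∈ b :: l, (∀ a' ∈ b :: l, (selected s (nm a) (sel a)).length ≤
        (selected s (nm a') (sel a')).length) ∧
      (withMin nm sel k b l).exec s = (((k a).exec s).1, ((k a).exec s).2 + l.length) := by
  induction l generalizing b with
  | nil => exact ⟨b, by simp, by simp, rfl⟩
  | cons c l ih =>
    simp only [withMin, exec]
    split_ifs with h
    · obtain ⟨a, h1, h2, h3⟩ := ih b
      refine ⟨a, ?_, ?_, ?_⟩
      · rcases List.mem_cons.1 h1 with rfl | h1 <;> simp [*]
      · intro a' ha'
        rcases List.mem_cons.1 ha' with rfl | ha'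
        · exact h2 _ List.mem_cons_self
        · rcases List.mem_cons.1 ha' with rfl | ha'
          · exact (h2 b List.mem_cons_self).trans h
          · exact h2 _ (List.mem_cons_of_mem _ ha')
      · rw [h3]
        simp [add_assoc]
    · obtain ⟨a, h1, h2, h3⟩ := ih c
      refine ⟨a, List.mem_cons_of_mem _ h1, ?_, ?_⟩
      · intro a' ha'
        rcases List.mem_cons.1 ha' with rfl | ha'
        · exact (h2 c List.mem_cons_self).trans (not_le.1 h).le
        · exact h2 _ ha'
      · rw [h3]
        simp [add_assoc]

end Prog

/-! ### Registers for variables -/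

theorem List.Nodup.exists_map_eq {V Dom : Type*} [DecidableEq V] {args : List V} (hnd : args.Nodup)
    {t : List Dom} (ht : t.length = args.length) (d : V → Dom) :
    ∃ a : V → Dom, args.map a = t ∧ ∀ X, X ∉ args → a X = d X := by
  induction args generalizing t with
  | nil => exact ⟨d, by simpa using (List.length_eq_zero_iff.1 ht).symm, fun _ _ => rfl⟩
  | cons Y args ih =>
    obtain ⟨hY, hnd⟩ := List.nodup_cons.1 hnd
    cases t with
    | nil => simp at ht
    | cons e t =>
      obtain ⟨a, ha, had⟩ := ih hnd (by simpa using ht)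
      refine ⟨Function.update a Y e, ?_, fun X hX => ?_⟩
      · rw [List.map_cons, Function.update_self, ← ha]
        congr 1
        exact List.map_congr_left fun X hX =>
          Function.update_of_ne (fun h => hY (by rw [← h]; exact hX)) _ _
      · rw [List.mem_cons, not_or] at hX
        rw [Function.update_of_ne hX.1, had X hX.2]

namespace Prog

variable {ν Dom : Type*} {V : Type v} {g : V → ℕ} {U : Finset V}

theorem load_apply_of_notMem (out : List ℕ) (t : List Dom) (reg : ℕ → Dom) {n : ℕ}
    (hn : n ∉ out) : load out t reg n = reg n := by
  induction out generalizing t reg with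
  | nil => cases t <;> rfl
  | cons r out ih =>
    cases t with
    | nil => rfl
    | cons d t =>
      rw [load, ih _ _ fun h => hn (List.mem_cons_of_mem _ h),
        Function.update_of_ne fun h => hn (by rw [h]; exact List.mem_cons_self)]

theorem load_map (hg : Set.InjOn g U) {args : List V} (hnd : args.Nodup)
    (hU : ∀ X ∈ args, X ∈ U) (a : V → Dom) (reg : ℕ → Dom) {X : V} (hX : X ∈ args) :
    load (args.map g) (args.map a) reg (g X) = a X := by
  induction args generalizing reg with
  | nil => simp at hX
  | cons Y args ih =>
    obtain ⟨hY, hnd⟩ := List.nodup_cons.1 hnd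
    simp only [List.map_cons, load]
    rcases List.mem_cons.1 hX with rfl | hX
    · rw [load_apply_of_notMem, Function.update_self]
      intro h
      obtain ⟨Z, hZ, hgZ⟩ := List.mem_map.1 h
      have := hg (hU Z (List.mem_cons_of_mem _ hZ)) (hU X List.mem_cons_self) hgZ
      exact hY (this ▸ hZ)
    · exact ih hnd (fun Z hZ => hU Z (List.mem_cons_of_mem _ hZ)) _ hX

variable [DecidableEq Dom]

theorem matchSel_none (reg : ℕ → Dom) (n : ℕ) (t : List Dom) :
    matchSel reg (List.replicate n none) t = true ↔ t.length = n := by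
  induction n generalizing t with
  | zero => cases t <;> simp [matchSel]
  | succ n ih => cases t <;> simp [List.replicate_succ, matchSel, ih]

/-- The selection of those tuples over the columns `args` that agree with the registers on the
variables in `bs`. -/
def selOn [DecidableEq V] (g : V → ℕ) (args bs : List V) : List (Option ℕ) :=
  args.map fun X => if X ∈ bs then some (g X) else none

theorem matchSel_selOn [DecidableEq V] (reg : ℕ → Dom) (args bs : List V) (a : V → Dom) :
    matchSel reg (selOn g args bs) (args.map a) = true ↔
      ∀ X ∈ args, X ∈ bs → reg (g X) = a X := by
  induction args with
  | nil => simp [selOn, matchSel]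
  | cons Y args ih =>
    simp only [selOn, List.map_cons, List.forall_mem_cons] at ih ⊢
    by_cases hY : Y ∈ bs
    · simp [hY, matchSel, ih]
    · simp [hY, matchSel, ih]

/-- The tuples that match the selection `selOn g args bs` are those that are compatible with the
values of the variables in `bs`. -/
theorem mem_selected_selOn [DecidableEq V] {s : PState ν Dom} {r : ν} {args bs : List V}
    (hnd : args.Nodup) (hlen : ∀ t ∈ s.store r, t.length = args.length) {u : List Dom} :
    u ∈ selected s r (selOn g args bs) ↔ u ∈ s.store r ∧
      ∃ b : V → Dom, args.map b = u ∧ bs.map b = bs.map fun X => s.reg (g X) := by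
  rw [selected, List.mem_filter]
  refine and_congr_right fun hu => ⟨fun h => ?_, ?_⟩
  · obtain ⟨a, rfl, had⟩ := hnd.exists_map_eq (hlen u hu) fun X => s.reg (g X)
    refine ⟨a, rfl, List.map_congr_left fun X hX => ?_⟩
    by_cases hXa : X ∈ args
    · exact ((matchSel_selOn _ _ _ _).1 h X hXa hX).symm
    · exact had X hXa
  · rintro ⟨b, rfl, hb⟩
    rw [matchSel_selOn]
    exact fun X _ hX => (List.map_inj_left.1 hb X hX).symm

theorem length_selected_selOn [DecidableEq V] {s : PState ν Dom} {r : ν} {args bs : List V}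
    (hnd : args.Nodup) (hs : (s.store r).Nodup) {T : Finset (List Dom)}
    (hT : ∀ t, t ∈ s.store r ↔ t ∈ T) (hlen : ∀ t ∈ T, t.length = args.length) :
    (selected s r (selOn g args bs)).length =
      matchCount T args bs (bs.map fun X => s.reg (g X)) := by
  classical
  have h1 : (selected s r (selOn g args bs)).Nodup := hs.filter _
  rw [← List.toFinset_card_of_nodup h1, matchCount]
  congr 1
  ext u
  rw [List.mem_toFinset, mem_selected_selOn hnd fun t ht => hlen t ((hT t).1 ht), Finset.mem_filter,
    hT]

end Prog

/-! ### A worst-case optimal join program -/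

theorem one_le_matchCount {V Dom : Type*} {T : Finset (List Dom)} {args bs : List V}
    {t : List Dom} :
    1 ≤ matchCount T args bs t ↔ ∃ b : V → Dom, args.map b ∈ T ∧ bs.map b = t := by
  classical
  rw [matchCount, Nat.one_le_iff_ne_zero, Finset.card_ne_zero, Finset.filter_nonempty_iff]
  constructor
  · rintro ⟨u, hu, b, rfl, hb⟩
    exact ⟨b, hu, hb⟩
  · rintro ⟨b, hu, hb⟩
    exact ⟨_, hu, b, rfl, hb⟩

/-- The time of a loop over `T` in which the iteration for `t` does `m t` iterations of an inner
loop. -/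
theorem cast_le_of_le_one_add_sum {κ : Type*} {T : Finset κ} {m : κ → ℕ} {c n : ℕ} {B : ℝ}
    (hc : c ≤ 1 + ∑ t ∈ T, (1 + m t * (n + 2) + n + 1)) (hB : 1 ≤ B) (hT : (T.card : ℝ) ≤ B)
    (hm : ∑ t ∈ T, (m t : ℝ) ≤ B) : (c : ℝ) ≤ (2 * n + 5) * B := by
  have hc' : (c : ℝ) ≤ 1 + ∑ t ∈ T, (1 + (m t : ℝ) * (n + 2) + n + 1) := by exact_mod_cast hc
  have h1 : ∑ t ∈ T, (1 + (m t : ℝ) * (n + 2) + n + 1) =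
      (n + 2) * T.card + (n + 2) * ∑ t ∈ T, (m t : ℝ) := by
    rw [Finset.mul_sum, mul_comm, ← nsmul_eq_mul, ← Finset.sum_const, ← Finset.sum_add_distrib]
    exact Finset.sum_congr rfl fun t _ => by ring
  have hn : (0 : ℝ) ≤ n + 2 := by positivity
  have h2 := mul_le_mul_of_nonneg_left hT hn
  have h3 := mul_le_mul_of_nonneg_left hm hn
  linarith

namespace Prog

variable {R : Type u} {V : Type v} {σ : Signature R} {Dom : Type x}

/-- `t` is a tuple over the columns `bs` such that every atom in `E` has a tuple that agrees
with it. -/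
def InJoin (D : Database σ Dom) (E : Finset (QAtom σ V)) (bs : List V) (t : List Dom) : Prop :=
  (∃ a : V → Dom, t = bs.map a) ∧ ∀ A ∈ E, 1 ≤ matchCount (D.rel A.sym) A.args bs t

/-- The intended contents `Tgt` of the names are those of the database for the relation symbols, and
the name `e` is unused. -/
structure Fits (D : Database σ Dom) (e : ℕ) (Tgt : R ⊕ ℕ → List Dom → Prop) : Prop where
  base : ∀ r t, Tgt (.inl r) t ↔ t ∈ D.rel r
  empty : ∀ t, ¬ Tgt (.inr e) t

variable {g : V → ℕ} {U : Finset V} {D : Database σ Dom} {e : ℕ}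
  {Tgt : R ⊕ ℕ → List Dom → Prop} {s : PState (R ⊕ ℕ) Dom} {E : Finset (QAtom σ V)}

theorem InJoin.length {bs : List V} {t : List Dom} (h : InJoin D E bs t) :
    t.length = bs.length := by
  obtain ⟨⟨a, rfl⟩, -⟩ := h
  simp

/-- The state stores exactly the database under the names of the relation symbols. -/
theorem Fits.mem_store (h : Fits D e Tgt) (hs : s.Sound Tgt) (hb : ∀ r, s.Full Tgt (.inl r))
    (r : R) (t : List Dom) : t ∈ s.store (.inl r) ↔ t ∈ D.rel r :=
  ⟨fun ht => (h.base r t).1 ((hs _).2 t ht), fun ht => hb r t ((h.base r t).2 ht)⟩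

/-- For each tuple of the relation `r` with columns `bs`: load it into the registers of these
variables and run `p`. -/
def forTuples (g : V → ℕ) (r : R ⊕ ℕ) (bs : List V) (p : Prog (R ⊕ ℕ)) : Prog (R ⊕ ℕ) :=
  forEach r (List.replicate bs.length none) (bs.map g) p

/-- The rule for `forTuples`: the body may assume that the registers hold the tuple `t`. -/
theorem exec_forTuples [DecidableEq R] [DecidableEq Dom] (hg : Set.InjOn g U) {bs : List V}
    (hnd : bs.Nodup) (hU : ∀ X ∈ bs, X ∈ U) (hs : s.Sound Tgt) {r : R ⊕ ℕ}
    (hr : ∀ t, Tgt r t → ∃ a : V → Dom, t = bs.map a)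
    (G : List Dom → PState (R ⊕ ℕ) Dom → Prop) (f : List Dom → ℕ) {p : Prog (R ⊕ ℕ)}
    (hbody : ∀ s', s.Le s' → s'.Sound Tgt → ∀ t, Tgt r t → (bs.map fun X => s'.reg (g X)) = t →
      (p.exec s').1.Sound Tgt ∧ G t (p.exec s').1 ∧ (p.exec s').2 ≤ f t)
    (hG : ∀ t s₁ s₂, G t s₁ → PState.Le s₁ s₂ → G t s₂) :
    ((forTuples g r bs p).exec s).1.Sound Tgt ∧
      (∀ t ∈ s.store r, G t ((forTuples g r bs p).exec s).1) ∧
      ((forTuples g r bs p).exec s).2 ≤ 1 + ∑ t ∈ (s.store r).toFinset, (f t + 1) := by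
  have hsel : selected s r (List.replicate bs.length none) = s.store r := by
    rw [selected, List.filter_eq_self]
    intro t ht
    obtain ⟨a, rfl⟩ := hr t ((hs r).2 t ht)
    rw [matchSel_none, List.length_map]
  have := exec_forEach (p := p) (r := r) (sel := List.replicate bs.length none)
    (out := bs.map g) (s := s) (fun s' => s'.Sound Tgt) G f hs ?_ hG
  · rw [hsel] at this
    rwa [List.sum_toFinset _ (hs r).1]
  · intro s' hle hs' t ht
    rw [hsel] at ht
    have ht' := (hs r).2 t ht
    obtain ⟨a, rfl⟩ := hr t ht'
    exact hbody { s' with reg := load (bs.map g) (bs.map a) s'.reg } hle hs' _ ht'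
      (List.map_congr_left fun X hX => load_map hg hnd hU a s'.reg hX)

variable [DecidableEq V]

theorem Fits.length_selected [DecidableEq Dom] (h : Fits D e Tgt) (hs : s.Sound Tgt)
    (hb : ∀ r, s.Full Tgt (.inl r)) (A : QAtom σ V) (bs : List V) :
    (selected s (.inl A.sym) (selOn g A.args bs)).length =
      matchCount (D.rel A.sym) A.args bs (bs.map fun X => s.reg (g X)) :=
  length_selected_selOn A.nodup (hs _).1 (h.mem_store hs hb A.sym) fun t ht =>
    (D.length_eq _ t ht).trans A.length_eq.symm

/-- The atoms in `E` cover the variables `F`, and their relations have at most `M` tuples. -/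
structure Covers (D : Database σ Dom) (E : Finset (QAtom σ V)) (F : Finset V) (M : ℕ) : Prop where
  cover : ∀ X ∈ F, ∃ A ∈ E, X ∈ A.vars
  pos : 1 ≤ M
  card_le : ∀ A ∈ E, (D.rel A.sym).card ≤ M

variable {F : Finset V} {M : ℕ}

theorem Covers.one_le (h : Covers D E F M) :
    (1 : ℝ) ≤ (M : ℝ) ^ (fractionalCoverNumber E F : ℝ) :=
  Real.one_le_rpow (by exact_mod_cast h.pos) (NNReal.coe_nonneg _)

theorem Covers.card_store_le [DecidableEq Dom] (h : Covers D E F M) {bs : List V}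
    (hbs : ∀ X ∈ bs, X ∈ F) {L : List (List Dom)} (hL : ∀ t ∈ L, InJoin D E bs t) :
    (L.toFinset.card : ℝ) ≤ (M : ℝ) ^ (fractionalCoverNumber E F : ℝ) :=
  card_le_rpow_fractionalCoverNumber h.cover (fun A => D.rel A.sym) h.pos h.card_le hbs _
    (fun t ht => (hL t (List.mem_toFinset.1 ht)).length)
    (fun t ht => (hL t (List.mem_toFinset.1 ht)).2)

variable [DecidableEq R] [DecidableEq Dom]

/-- Insert the values of the variables `bs` into `r`, if every atom in `E` has a tuple that agrees
with them. -/
noncomputable def insertIfJoins (g : V → ℕ) (e : ℕ) (E : Finset (QAtom σ V)) (r : R ⊕ ℕ)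
    (bs : List V) : Prog (R ⊕ ℕ) :=
  ifNonempty (.inr e) (E.toList.map fun A => (.inl A.sym, selOn g A.args bs))
    (insert r (bs.map g))

/-- Take the candidates for the values of `X` from an atom of the list that has fewest tuples
agreeing with the values of the variables `bs`, and insert the extended tuples that pass the test
of `insertIfJoins` into `r'`. -/
noncomputable def extendTuple (g : V → ℕ) (e : ℕ) (E : Finset (QAtom σ V)) (r' : R ⊕ ℕ)
    (X : V) (bs : List V) : List (QAtom σ V) → Prog (R ⊕ ℕ)
  | [] => skip
  | B :: l => withMin (fun A => .inl A.sym) (fun A => selOn g A.args bs)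
      (fun A => forEach (.inl A.sym) (selOn g A.args bs) (A.args.map g)
        (insertIfJoins g e E r' (X :: bs))) B l

/-- Extend each tuple of `r`, with columns `bs`, by the values of `X` for which the extended tuple
belongs to the join of the atoms in `E`; the result goes to `r'`. -/
noncomputable def extendJoin (g : V → ℕ) (e : ℕ) (E : Finset (QAtom σ V)) (r r' : R ⊕ ℕ)
    (X : V) (bs : List V) : Prog (R ⊕ ℕ) :=
  forTuples g r bs (extendTuple g e E r' X bs (E.filter fun A => X ∈ A.vars).toList)

/-- Compute the join of the atoms in `E` one variable at a time; the tuples over the last `i`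
variables are stored under the name `nm i`. -/
noncomputable def joinAtoms (g : V → ℕ) (e : ℕ) (E : Finset (QAtom σ V)) (nm : ℕ → R ⊕ ℕ) :
    List V → Prog (R ⊕ ℕ)
  | [] => insertIfJoins g e E (nm 0) []
  | X :: bs => seq (joinAtoms g e E nm bs)
      (extendJoin g e E (nm bs.length) (nm (bs.length + 1)) X bs)

/-- Compute the join of the atoms in `E` over the columns `vs`, and insert into `r` those of its
tuples whose restrictions belong to all the relations in `ch`, given with their columns. -/
noncomputable def joinView (g : V → ℕ) (e : ℕ) (E : Finset (QAtom σ V)) (nm : ℕ → R ⊕ ℕ)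
    (ch : List ((R ⊕ ℕ) × List V)) (r : R ⊕ ℕ) (vs : List V) : Prog (R ⊕ ℕ) :=
  seq (joinAtoms g e E nm vs) (forTuples g (nm vs.length) vs
    (ifAllMem (ch.map fun c => (c.1, c.2.map g)) (insert r (vs.map g))))

/-- Insert into `r'` the restrictions to the columns `ws` of the tuples of `r` with columns `vs`. -/
def projView (g : V → ℕ) (r : R ⊕ ℕ) (vs : List V) (r' : R ⊕ ℕ) (ws : List V) :
    Prog (R ⊕ ℕ) :=
  forTuples g r vs (insert r' (ws.map g))

theorem exec_insertIfJoins (hf : Fits D e Tgt) (hs : s.Sound Tgt)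
    (hb : ∀ r, s.Full Tgt (.inl r)) {r : R ⊕ ℕ} {bs : List V}
    (hr : ∀ t, Tgt r t ↔ InJoin D E bs t) :
    ((insertIfJoins g e E r bs).exec s).1.Sound Tgt ∧
      ((insertIfJoins g e E r bs).exec s).1.reg = s.reg ∧
      (InJoin D E bs (bs.map fun X => s.reg (g X)) →
        (bs.map fun X => s.reg (g X)) ∈ ((insertIfJoins g e E r bs).exec s).1.store r) ∧
      ((insertIfJoins g e E r bs).exec s).2 ≤ E.card + 1 := by
  have he : s.store (.inr e) = [] :=
    List.eq_nil_iff_forall_not_mem.2 fun t ht => hf.empty t ((hs _).2 t ht)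
  have hiff : InJoin D E bs (bs.map fun X => s.reg (g X)) ↔
      ∀ a ∈ E.toList.map fun A => ((.inl A.sym : R ⊕ ℕ), selOn g A.args bs),
        selected s a.1 a.2 ≠ [] := by
    simp only [List.forall_mem_map, Finset.mem_toList, InJoin, Nat.one_le_iff_ne_zero]
    rw [and_iff_right ⟨_, rfl⟩]
    refine forall₂_congr fun A _ => ?_
    rw [← hf.length_selected hs hb, Ne, List.length_eq_zero_iff]
  obtain ⟨h1, h2⟩ := exec_ifNonempty he
    (E.toList.map fun A => ((.inl A.sym : R ⊕ ℕ), selOn g A.args bs)) (insert r (bs.map g))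
  rw [List.length_map, Finset.length_toList] at h1 h2
  by_cases hj : InJoin D E bs (bs.map fun X => s.reg (g X))
  · have hmap : (bs.map g).map s.reg = bs.map fun X => s.reg (g X) := by
      rw [List.map_map]
      rfl
    obtain ⟨h3, h4, h5, h6⟩ := exec_insert (t := bs.map g) hs (r := r) (by
      rw [hmap]
      exact (hr _).2 hj)
    rw [insertIfJoins, h1 (hiff.1 hj)]
    refine ⟨h3, h4, fun _ => hmap ▸ h5, ?_⟩
    simp only [h6]
    omega
  · obtain ⟨h3, h4⟩ := h2 (fun h => hj (hiff.2 h))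
    rw [insertIfJoins, h3]
    exact ⟨hs, rfl, fun h => absurd h hj, h4⟩

/-- The inner loop of `extendJoin`, over the tuples of `A` that agree with the values of `bs`. -/
theorem exec_forEach_insertIfJoins (hg : Set.InjOn g U) (hf : Fits D e Tgt) (hs : s.Sound Tgt)
    (hb : ∀ r, s.Full Tgt (.inl r)) {r' : R ⊕ ℕ} {X : V} {bs : List V}
    (hU : ∀ Y ∈ bs, Y ∈ U) (hr' : ∀ t, Tgt r' t ↔ InJoin D E (X :: bs) t) {A : QAtom σ V}
    (hA : A ∈ E) (hX : X ∈ A.args) (hAU : ∀ Y ∈ A.args, Y ∈ U) :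
    let res := (forEach (.inl A.sym) (selOn g A.args bs) (A.args.map g)
      (insertIfJoins g e E r' (X :: bs))).exec s
    res.1.Sound Tgt ∧
      (∀ t, InJoin D E (X :: bs) t → t.tail = (bs.map fun Y => s.reg (g Y)) →
        t ∈ res.1.store r') ∧
      res.2 ≤ 1 + matchCount (D.rel A.sym) A.args bs (bs.map fun Y => s.reg (g Y)) *
        (E.card + 2) := by
  intro res
  have hlen : ∀ t ∈ s.store (.inl A.sym), t.length = A.args.length := fun t ht =>
    (D.length_eq _ t ((hf.mem_store hs hb _ _).1 ht)).trans A.length_eq.symm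
  have key := exec_forEach (p := insertIfJoins g e E r' (X :: bs))
    (r := .inl A.sym) (sel := selOn g A.args bs) (out := A.args.map g) (s := s)
    (fun s' => s'.Sound Tgt ∧ ∀ Y ∈ bs, s'.reg (g Y) = s.reg (g Y))
    (fun u s' => ∀ t, InJoin D E (X :: bs) t → t.tail = (bs.map fun Y => s.reg (g Y)) →
      (∃ b : V → Dom, A.args.map b = u ∧ (X :: bs).map b = t) → t ∈ s'.store r')
    (fun _ => E.card + 1) ⟨hs, fun _ _ => rfl⟩ ?_
    (fun u s₁ s₂ h hle t ht ht' hb' => hle _ t (h t ht ht' hb'))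
  · obtain ⟨h1, h2, h3⟩ := key
    refine ⟨h1.1, fun t ht htail => ?_, h3.trans ?_⟩
    · obtain ⟨b, hbA, hbt⟩ := one_le_matchCount.1 (ht.2 A hA)
      refine h2 (A.args.map b) ?_ t ht htail ⟨b, rfl, hbt⟩
      rw [mem_selected_selOn A.nodup hlen]
      refine ⟨(hf.mem_store hs hb _ _).2 hbA, b, rfl, ?_⟩
      rw [← htail, ← hbt]
      rfl
    · rw [List.map_const', List.sum_replicate, hf.length_selected hs hb, smul_eq_mul]
  · intro s' hle hs' u hu
    obtain ⟨hs', hreg⟩ := hs'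
    obtain ⟨-, b, rfl, hbs⟩ := (mem_selected_selOn A.nodup hlen).1 hu
    set s₁ : PState (R ⊕ ℕ) Dom :=
      { s' with reg := load (A.args.map g) (A.args.map b) s'.reg } with hs₁
    have hregA : ∀ Y ∈ A.args, s₁.reg (g Y) = b Y := fun Y hY =>
      load_map hg A.nodup hAU b s'.reg hY
    -- Loading the tuple keeps the values of `bs`, with which the tuple agrees.
    have hregbs : ∀ Y ∈ bs, s₁.reg (g Y) = s.reg (g Y) := by
      intro Y hY
      by_cases hYA : Y ∈ A.args
      · rw [hregA Y hYA]
        exact List.map_inj_left.1 hbs Y hY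
      · rw [← hreg Y hY]
        refine load_apply_of_notMem _ _ _ fun h => hYA ?_
        obtain ⟨Z, hZ, hgZ⟩ := List.mem_map.1 h
        exact hg (hAU Z hZ) (hU Y hY) hgZ ▸ hZ
    obtain ⟨h4, h5, h6, h7⟩ := exec_insertIfJoins (g := g) (s := s₁) hf hs'
      (fun r => (hb r).mono hle) hr'
    refine ⟨⟨h4, fun Y hY => by rw [h5, hregbs Y hY]⟩, ?_, h7⟩
    rintro t ht htail ⟨b', hb'A, hb't⟩
    have : t = (X :: bs).map fun Y => s₁.reg (g Y) := by
      rw [← hb't, List.map_cons, List.map_cons, hregA X hX, List.map_inj_left.1 hb'A X hX]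
      congr 1
      rw [List.map_congr_left hregbs, ← htail, ← hb't]
      rfl
    rw [this] at ht ⊢
    exact h6 ht

/-- The inner loop is over an atom with fewest matches, so the number of matches in any atom `B` of
the list bounds the time. -/
theorem exec_extendTuple (hg : Set.InjOn g U) (hf : Fits D e Tgt) (hs : s.Sound Tgt)
    (hb : ∀ r, s.Full Tgt (.inl r)) {r' : R ⊕ ℕ} {X : V} {bs : List V}
    (hU : ∀ Y ∈ bs, Y ∈ U) (hE : ∀ A ∈ E, ∀ Y ∈ A.args, Y ∈ U)
    (hr' : ∀ t, Tgt r' t ↔ InJoin D E (X :: bs) t) {l : List (QAtom σ V)}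
    (hl : ∀ A ∈ l, A ∈ E ∧ X ∈ A.vars) (hcard : l.length ≤ E.card) {B : QAtom σ V}
    (hB : B ∈ l) :
    ((extendTuple g e E r' X bs l).exec s).1.Sound Tgt ∧
      (∀ t, InJoin D E (X :: bs) t → t.tail = (bs.map fun Y => s.reg (g Y)) →
        t ∈ ((extendTuple g e E r' X bs l).exec s).1.store r') ∧
      ((extendTuple g e E r' X bs l).exec s).2 ≤
        1 + matchCount (D.rel B.sym) B.args bs (bs.map fun Y => s.reg (g Y)) * (E.card + 2) +
          E.card := by
  cases l with
  | nil => cases hB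
  | cons C l =>
    obtain ⟨A, hA, hmin, hexec⟩ := exec_withMin (s := s) (fun A : QAtom σ V => .inl A.sym)
      (fun A => selOn g A.args bs)
      (fun A => forEach (.inl A.sym) (selOn g A.args bs) (A.args.map g)
          (insertIfJoins g e E r' (X :: bs))) C l
    obtain ⟨hAE, hXA⟩ := hl A hA
    obtain ⟨h1, h2, h3⟩ := exec_forEach_insertIfJoins (s := s) hg hf hs hb hU hr' hAE
      (List.mem_toFinset.1 hXA) (hE A hAE)
    rw [extendTuple, hexec]
    refine ⟨h1, h2, ?_⟩
    have hAB := hmin B hB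
    rw [hf.length_selected hs hb, hf.length_selected hs hb] at hAB
    have h4 := Nat.mul_le_mul_right (E.card + 2) hAB
    rw [List.length_cons] at hcard
    exact add_le_add (h3.trans (Nat.add_le_add_left h4 1)) (Nat.le_of_succ_le hcard)

theorem exec_extendJoin (hg : Set.InjOn g U) (hf : Fits D e Tgt) (hs : s.Sound Tgt)
    (hb : ∀ r, s.Full Tgt (.inl r)) (hF : Covers D E F M) {r r' : R ⊕ ℕ} {X : V} {bs : List V}
    (hnd : bs.Nodup) (hFU : F ⊆ U) (hbs : ∀ Y ∈ X :: bs, Y ∈ F)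
    (hE : ∀ A ∈ E, ∀ Y ∈ A.args, Y ∈ U)
    (hr : ∀ t, Tgt r t ↔ InJoin D E bs t) (hr' : ∀ t, Tgt r' t ↔ InJoin D E (X :: bs) t)
    (hfull : s.Full Tgt r) :
    ((extendJoin g e E r r' X bs).exec s).1.Sound Tgt ∧
      ((extendJoin g e E r r' X bs).exec s).1.Full Tgt r' ∧
      (((extendJoin g e E r r' X bs).exec s).2 : ℝ) ≤
        (2 * E.card + 5) * (M : ℝ) ^ (fractionalCoverNumber E F : ℝ) := by
  have hXF : X ∈ F := hbs X List.mem_cons_self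
  have hbsF : ∀ Y ∈ bs, Y ∈ F := fun Y hY => hbs Y (List.mem_cons_of_mem _ hY)
  have hbsU : ∀ Y ∈ bs, Y ∈ U := fun Y hY => hFU (hbsF Y hY)
  have hmem : ∀ A, A ∈ (E.filter fun A : QAtom σ V => X ∈ A.vars).toList ↔ A ∈ E ∧ X ∈ A.vars := by
    simp
  have hcard : (E.filter fun A : QAtom σ V => X ∈ A.vars).toList.length ≤ E.card := by
    rw [Finset.length_toList]
    exact Finset.card_filter_le _ _
  -- The number of candidates for the value of `X` that are enumerated for the tuple `t`.
  obtain ⟨m, hm1, hm2⟩ : ∃ m : List Dom → ℕ,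
      (∀ t, ∀ A ∈ E, X ∈ A.vars → m t ≤ matchCount (D.rel A.sym) A.args bs t) ∧
      ∀ t, ∃ A ∈ (E.filter fun A : QAtom σ V => X ∈ A.vars).toList,
        m t = matchCount (D.rel A.sym) A.args bs t := by
    have hne : (E.filter fun A : QAtom σ V => X ∈ A.vars).Nonempty := by
      obtain ⟨A, hA, hXA⟩ := hF.cover X hXF
      exact ⟨A, Finset.mem_filter.2 ⟨hA, hXA⟩⟩
    refine ⟨fun t => (E.filter fun A : QAtom σ V => X ∈ A.vars).inf' hne fun A =>
      matchCount (D.rel A.sym) A.args bs t,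
      fun _ A hA hXA => Finset.inf'_le _ (Finset.mem_filter.2 ⟨hA, hXA⟩), fun t => ?_⟩
    obtain ⟨A, hA, h⟩ := Finset.exists_mem_eq_inf' hne fun A =>
      matchCount (D.rel A.sym) A.args bs t
    exact ⟨A, Finset.mem_toList.2 hA, h⟩
  unfold extendJoin
  generalize (E.filter fun A : QAtom σ V => X ∈ A.vars).toList = l at hmem hcard hm2 ⊢
  have key := exec_forTuples (s := s) (r := r) (p := extendTuple g e E r' X bs l) hg hnd hbsU hs
    (fun t ht => ((hr t).1 ht).1)
    (fun t s' => ∀ t', InJoin D E (X :: bs) t' → t'.tail = t → t' ∈ s'.store r')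
    (fun t => 1 + m t * (E.card + 2) + E.card) ?_
    (fun t s₁ s₂ h hle t' ht' htt => hle _ _ (h t' ht' htt))
  · obtain ⟨h1, h2, h3⟩ := key
    refine ⟨h1, ?_, ?_⟩
    · intro t ht
      rw [hr'] at ht
      refine h2 t.tail (hfull _ ((hr _).2 ?_)) t ht rfl
      obtain ⟨⟨a, rfl⟩, h4⟩ := ht
      exact ⟨⟨a, rfl⟩, fun A hA => (h4 A hA).trans (matchCount_cons_le _ _ _ _ _)⟩
    · have hL : ∀ t ∈ s.store r, InJoin D E bs t := fun t ht => (hr t).1 ((hs r).2 t ht)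
      have hsum := sum_min_le_rpow_fractionalCoverNumber hF.cover (fun A => D.rel A.sym) hF.pos
        hF.card_le hbsF (s.store r).toFinset
        (fun t ht => (hL t (List.mem_toFinset.1 ht)).length)
        (fun t ht => (hL t (List.mem_toFinset.1 ht)).2) hXF m (fun t _ => hm1 t)
      exact cast_le_of_le_one_add_sum h3 hF.one_le (hF.card_store_le hbsF hL) hsum
  · intro s' hle hs' t _ htreg
    obtain ⟨B, hB, hmB⟩ := hm2 t
    have := exec_extendTuple (s := s') hg hf hs' (fun r => (hb r).mono hle) hbsU hE hr'
      (fun A hA => (hmem A).1 hA) hcard hB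
    rwa [htreg, ← hmB] at this

/-- Each level of the join is contained in a join whose size is bounded by the fractional edge cover
number of `F`, and so is the number of the candidates for the next column. -/
theorem exec_joinAtoms (hg : Set.InjOn g U) (hf : Fits D e Tgt) (hs : s.Sound Tgt)
    (hb : ∀ r, s.Full Tgt (.inl r)) (hF : Covers D E F M) {nm : ℕ → R ⊕ ℕ} {bs : List V}
    (hnd : bs.Nodup) (hFU : F ⊆ U) (hbs : ∀ Y ∈ bs, Y ∈ F) (hE : ∀ A ∈ E, ∀ Y ∈ A.args, Y ∈ U)
    (hnm : ∀ cs, cs <:+ bs → ∀ t, Tgt (nm cs.length) t ↔ InJoin D E cs t) :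
    ((joinAtoms g e E nm bs).exec s).1.Sound Tgt ∧
      ((joinAtoms g e E nm bs).exec s).1.Full Tgt (nm bs.length) ∧
      (((joinAtoms g e E nm bs).exec s).2 : ℝ) ≤
        (bs.length + 1) * (2 * E.card + 5) * (M : ℝ) ^ (fractionalCoverNumber E F : ℝ) := by
  have hone := hF.one_le
  induction bs with
  | nil =>
    obtain ⟨h1, -, h2, h3⟩ := exec_insertIfJoins (g := g) (r := nm 0) (bs := []) hf hs hb
      (hnm [] (List.nil_suffix))
    refine ⟨h1, fun t ht => ?_, ?_⟩
    · have hj := (hnm [] List.nil_suffix t).1 ht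
      obtain rfl : t = [] := List.length_eq_zero_iff.1 hj.length
      exact h2 hj
    · have h4 : (((joinAtoms g e E nm []).exec s).2 : ℝ) ≤ E.card + 1 := by exact_mod_cast h3
      rw [List.length_nil, Nat.cast_zero, zero_add, one_mul]
      nlinarith [(Nat.cast_nonneg E.card : (0 : ℝ) ≤ E.card)]
  | cons X bs ih =>
    have hsuf : bs <:+ X :: bs := List.suffix_cons X bs
    have hnd' := (List.nodup_cons.1 hnd).2
    obtain ⟨h1, h2, h3⟩ := ih hnd' (fun Y hY => hbs Y (List.mem_cons_of_mem _ hY))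
      fun cs hcs => hnm cs (hcs.trans hsuf)
    obtain ⟨h4, h5, h6⟩ := exec_extendJoin (r := nm bs.length) (r' := nm (bs.length + 1)) hg hf h1
      (fun r => (hb r).mono (le_exec _ s)) hF hnd' hFU hbs hE (hnm bs hsuf)
      (hnm (X :: bs) List.suffix_rfl) h2
    refine ⟨h4, h5, ?_⟩
    simp only [joinAtoms, exec, Nat.cast_add, List.length_cons, Nat.cast_one]
    linarith

theorem exec_joinView (hg : Set.InjOn g U) (hf : Fits D e Tgt) (hs : s.Sound Tgt)
    (hb : ∀ r, s.Full Tgt (.inl r)) (hF : Covers D E F M) {nm : ℕ → R ⊕ ℕ} {vs : List V}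
    (hnd : vs.Nodup) (hFU : F ⊆ U) (hvs : ∀ Y ∈ vs, Y ∈ F) (hE : ∀ A ∈ E, ∀ Y ∈ A.args, Y ∈ U)
    (hnm : ∀ cs, cs <:+ vs → ∀ t, Tgt (nm cs.length) t ↔ InJoin D E cs t)
    {ch : List ((R ⊕ ℕ) × List V)} (hch : ∀ c ∈ ch, s.Full Tgt c.1 ∧ ∀ X ∈ c.2, X ∈ vs)
    {r : R ⊕ ℕ} (hr : ∀ t, Tgt r t ↔
      InJoin D E vs t ∧ ∃ a : V → Dom, t = vs.map a ∧ ∀ c ∈ ch, Tgt c.1 (c.2.map a)) :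
    ((joinView g e E nm ch r vs).exec s).1.Sound Tgt ∧
      ((joinView g e E nm ch r vs).exec s).1.Full Tgt r ∧
      (((joinView g e E nm ch r vs).exec s).2 : ℝ) ≤
        ((vs.length + 1) * (2 * E.card + 5) + (ch.length + 3)) *
          (M : ℝ) ^ (fractionalCoverNumber E F : ℝ) := by
  obtain ⟨h1, h2, h3⟩ := exec_joinAtoms hg hf hs hb hF hnd hFU hvs hE hnm
  set s₁ := ((joinAtoms g e E nm vs).exec s).1 with hs₁
  have hnmv := hnm vs List.suffix_rfl
  have key := exec_forTuples (s := s₁) (r := nm vs.length)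
    (p := ifAllMem (ch.map fun c => (c.1, c.2.map g)) (insert r (vs.map g))) hg hnd
    (fun Y hY => hFU (hvs Y hY)) h1 (fun t ht => ((hnmv t).1 ht).1)
    (fun t s' => Tgt r t → t ∈ s'.store r) (fun _ => ch.length + 1) ?_
    (fun t s₁ s₂ h hle ht => hle _ _ (h ht))
  · obtain ⟨h4, h5, h6⟩ := key
    refine ⟨h4, fun t ht => h5 t (h2 t ((hnmv t).2 ((hr t).1 ht).1)) ht, ?_⟩
    have hcard := hF.card_store_le hvs (L := s₁.store (nm vs.length))
      fun t ht => (hnmv t).1 ((h1 _).2 t ht)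
    have hone := hF.one_le
    rw [Finset.sum_const, smul_eq_mul] at h6
    have h6' : (((forTuples g (nm vs.length) vs
        (ifAllMem (ch.map fun c => (c.1, c.2.map g)) (insert r (vs.map g)))).exec s₁).2 : ℝ) ≤
        1 + (s₁.store (nm vs.length)).toFinset.card * (ch.length + 1 + 1) := by exact_mod_cast h6
    have h7 := mul_le_mul_of_nonneg_right hcard (by positivity : (0 : ℝ) ≤ ch.length + 1 + 1)
    simp only [joinView, exec, Nat.cast_add]
    rw [← hs₁]
    linarith
  · intro s' hle hs' t ht htreg
    have hiff : Tgt r t ↔ ∀ c ∈ ch.map fun c => (c.1, c.2.map g),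
        c.2.map s'.reg ∈ s'.store c.1 := by
      have hmem : ∀ c ∈ ch, ∀ u, Tgt c.1 u ↔ u ∈ s'.store c.1 := fun c hc u =>
        ⟨((hch c hc).1.mono ((le_exec _ s).trans hle)) u, (hs' _).2 u⟩
      simp only [List.forall_mem_map, List.map_map]
      rw [hr, and_iff_right ((hnmv t).1 ht)]
      constructor
      · rintro ⟨a, rfl, ha⟩ c hc
        rw [← hmem c hc]
        convert ha c hc using 1
        exact List.map_congr_left fun X hX => List.map_inj_left.1 htreg X ((hch c hc).2 X hX)
      · exact fun h => ⟨_, htreg.symm, fun c hc => (hmem c hc _).2 (h c hc)⟩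
    obtain ⟨h4, h5⟩ := exec_ifAllMem (s := s') (ch.map fun c => (c.1, c.2.map g))
      (insert r (vs.map g))
    rw [List.length_map] at h4 h5
    by_cases h : Tgt r t
    · have hmap : (vs.map g).map s'.reg = t := by
        rw [← htreg, List.map_map]
        rfl
      obtain ⟨h6, -, h7, h8⟩ := exec_insert (t := vs.map g) (r := r) hs' (hmap.symm ▸ h)
      rw [h4 (hiff.1 h)]
      refine ⟨h6, fun _ => hmap ▸ h7, ?_⟩
      simp only [h8]
      omega
    · obtain ⟨h6, h7⟩ := h5 fun h' => h (hiff.2 h')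
      rw [h6]
      exact ⟨hs', fun h' => absurd h' h, h7⟩

theorem exec_projView (hg : Set.InjOn g U) (hs : s.Sound Tgt) (hF : Covers D E F M)
    {vs ws : List V} (hnd : vs.Nodup) (hFU : F ⊆ U) (hvs : ∀ Y ∈ vs, Y ∈ F)
    (hws : ∀ Y ∈ ws, Y ∈ vs) {r r' : R ⊕ ℕ} (hr : ∀ t, Tgt r t → InJoin D E vs t)
    (hfull : s.Full Tgt r)
    (hr' : ∀ t, Tgt r' t ↔ ∃ a : V → Dom, Tgt r (vs.map a) ∧ t = ws.map a) :
    ((projView g r vs r' ws).exec s).1.Sound Tgt ∧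
      ((projView g r vs r' ws).exec s).1.Full Tgt r' ∧
      (((projView g r vs r' ws).exec s).2 : ℝ) ≤
        3 * (M : ℝ) ^ (fractionalCoverNumber E F : ℝ) := by
  have key := exec_forTuples (s := s) (r := r) (p := insert r' (ws.map g)) hg hnd
    (fun Y hY => hFU (hvs Y hY)) hs (fun t ht => (hr t ht).1)
    (fun t s' => ∀ a : V → Dom, t = vs.map a → ws.map a ∈ s'.store r') (fun _ => 1) ?_
    (fun t s₁ s₂ h hle a ha => hle _ _ (h a ha))
  · obtain ⟨h1, h2, h3⟩ := key
    refine ⟨h1, fun t ht => ?_, ?_⟩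
    · obtain ⟨a, ha, rfl⟩ := (hr' t).1 ht
      exact h2 _ (hfull _ ha) a rfl
    · have hcard := hF.card_store_le hvs (L := s.store r) fun t ht => hr t ((hs _).2 t ht)
      have hone := hF.one_le
      rw [Finset.sum_const, smul_eq_mul] at h3
      have h3' : (((projView g r vs r' ws).exec s).2 : ℝ) ≤
          1 + (s.store r).toFinset.card * (1 + 1) := by exact_mod_cast h3
      linarith
  · intro s' hle hs' t ht htreg
    have hmap : (ws.map g).map s'.reg = ws.map fun Y => s'.reg (g Y) := by
      rw [List.map_map]
      rfl
    obtain ⟨h4, -, h5, h6⟩ := exec_insert (t := ws.map g) (r := r') hs' (by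
      rw [hmap, hr']
      exact ⟨_, htreg.symm ▸ ht, rfl⟩)
    refine ⟨h4, fun a ha => ?_, h6.le⟩
    rw [← htreg] at ha
    have : ws.map a = (ws.map g).map s'.reg := by
      rw [hmap]
      exact List.map_congr_left fun Y hY => (List.map_inj_left.1 ha Y (hws Y hY)).symm
    rw [this]
    exact h5

end Prog

/-! ### Contents of views -/

namespace ViewTree

variable {R : Type u} {V : Type v} {σ : Signature R}

theorem IsNode.trans {S T U : ViewTree σ V} (h : S.IsNode T) (h' : T.IsNode U) : S.IsNode U := by
  obtain ⟨p, hp⟩ := h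
  obtain ⟨q, hq⟩ := h'
  exact ⟨q ++ p, by rw [nodeAt_append, hq]; exact hp⟩

theorem isNode_join {F : Finset V} {k : ℕ} (c : Fin k → ViewTree σ V) (i : Fin k) :
    (c i).IsNode (.join F k c) :=
  ⟨[i], by rw [nodeAt_singleton]; simp [child]⟩

theorem isNode_proj {F : Finset V} (c : ViewTree σ V) : c.IsNode (.proj F c) :=
  ⟨[0], by rw [nodeAt_singleton]; simp [child]⟩

theorem finite_isNode (T : ViewTree σ V) : {S : ViewTree σ V | S.IsNode T}.Finite := by
  induction T with
  | atom A => exact (Set.finite_singleton _).subset fun S hS => hS.eq_of_atom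
  | join F k c ih =>
    refine ((Set.finite_singleton (ViewTree.join F k c)).union (Set.finite_iUnion ih)).subset ?_
    intro S hS
    rcases hS.cases_join with h | ⟨i, hi⟩
    · exact Or.inl h
    · exact Or.inr (Set.mem_iUnion.2 ⟨i, hi⟩)
  | proj F c ih =>
    refine ((Set.finite_singleton (ViewTree.proj F c)).union ih).subset ?_
    intro S hS
    exact hS.cases_proj

/-- The order of the columns in which the content of a view is stored. -/
noncomputable def cols : ViewTree σ V → List V
  | atom A => A.args
  | join S _ _ => S.toList
  | proj S _ => S.toList

theorem nodup_cols (T : ViewTree σ V) : T.cols.Nodup := by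
  cases T with
  | atom A => exact A.nodup
  | join S k c => exact S.nodup_toList
  | proj S c => exact S.nodup_toList

variable [DecidableEq V]

theorem toFinset_cols (T : ViewTree σ V) : T.cols.toFinset = T.schema := by
  cases T with
  | atom A => rfl
  | join S k c => exact S.toList_toFinset
  | proj S c => exact S.toList_toFinset

theorem mem_cols {T : ViewTree σ V} {X : V} : X ∈ T.cols ↔ X ∈ T.schema := by
  rw [← toFinset_cols, List.mem_toFinset]

variable {Dom : Type x} {D : Database σ Dom}

/-- The content of a view depends only on the values of the variables in its schema. -/
theorem WellFormed.sat_congr {T : ViewTree σ V} (h : T.WellFormed) {a b : V → Dom}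
    (hab : ∀ X ∈ T.schema, a X = b X) (ha : T.Sat D a) : T.Sat D b := by
  induction T with
  | atom A =>
    have : A.args.map b = A.args.map a :=
      List.map_congr_left fun X hX => (hab X (List.mem_toFinset.2 hX)).symm
    rw [Sat, this]
    exact ha
  | join S k c ih =>
    refine fun i => ih i (h.2 i) (fun X hX => hab X ?_) (ha i)
    rw [schema, h.1]
    exact Finset.mem_biUnion.2 ⟨i, Finset.mem_univ i, hX⟩
  | proj S c =>
    obtain ⟨a', h1, h2⟩ := ha
    exact ⟨a', fun X hX => (h1 X hX).trans (hab X hX), h2⟩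

theorem WellFormed.sat_iff {T : ViewTree σ V} (h : T.WellFormed) (a : V → Dom) :
    T.Sat D a ↔ ∃ b, T.Sat D b ∧ T.cols.map a = T.cols.map b := by
  refine ⟨fun ha => ⟨a, ha, rfl⟩, ?_⟩
  rintro ⟨b, hb, hab⟩
  exact h.sat_congr (fun X hX => (List.map_inj_left.1 hab X (mem_cols.2 hX)).symm) hb

end ViewTree

/-! ### Names of the stored relations -/

section Names

variable {R : Type u} {V : Type v} {σ : Signature R} {Dom : Type x} {D : Database σ Dom}

open scoped Classical in
/-- The number of a view in the list `ns` of views. -/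
noncomputable def viewIndex (ns : List (ViewTree σ V)) (S : ViewTree σ V) : ℕ := ns.idxOf S

theorem getElem?_viewIndex {ns : List (ViewTree σ V)} {S : ViewTree σ V} (h : S ∈ ns) :
    ns[viewIndex ns S]? = some S := by
  classical
  exact List.getElem?_idxOf h

/-- The name under which the content of a view is stored: an atom is stored under its own symbol. -/
noncomputable def viewName (ns : List (ViewTree σ V)) : ViewTree σ V → R ⊕ ℕ
  | .atom A => .inl A.sym
  | S => .inr (Nat.pair (viewIndex ns S) 0)

/-- The name for the intermediate result over the last `i` columns in the computation of a join
view. -/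
noncomputable def levelName (ns : List (ViewTree σ V)) (S : ViewTree σ V) (i : ℕ) : R ⊕ ℕ :=
  .inr (Nat.pair (viewIndex ns S) (i + 1))

/-- The intended contents of all names. -/
noncomputable def target (ns : List (ViewTree σ V)) (D : Database σ Dom) :
    R ⊕ ℕ → List Dom → Prop
  | .inl r, t => t ∈ D.rel r
  | .inr n, t => ∃ S, ns[n.unpair.1]? = some S ∧
      match n.unpair.2 with
      | 0 => ∃ a, S.Sat D a ∧ t = S.cols.map a
      | i + 1 => Prog.InJoin D S.leaves.toFinset (S.cols.drop (S.cols.length - i)) t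

/-- The number of a name that stays unused. -/
def freeName (ns : List (ViewTree σ V)) : ℕ := Nat.pair ns.length 0

theorem fits_target (ns : List (ViewTree σ V)) (D : Database σ Dom) :
    Prog.Fits D (freeName ns) (target ns D) where
  base _ _ := Iff.rfl
  empty t := by simp [target, freeName]

theorem PState.Represents.sound {s : PState (R ⊕ ℕ) Dom} (h : s.Represents D)
    (ns : List (ViewTree σ V)) : s.Sound (target ns D) := by
  rintro (r | n)
  · exact ⟨(h.1 r).1, fun t ht => ((h.1 r).2 t).1 ht⟩
  · rw [h.2 n]
    simp

theorem target_levelName {ns : List (ViewTree σ V)} {S : ViewTree σ V} (h : S ∈ ns)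
    {cs : List V} (hcs : cs <:+ S.cols) (t : List Dom) :
    target ns D (levelName ns S cs.length) t ↔ Prog.InJoin D S.leaves.toFinset cs t := by
  simp only [target, levelName, Nat.unpair_pair, getElem?_viewIndex h, Option.some.injEq,
    exists_eq_left']
  rw [← List.suffix_iff_eq_drop.1 hcs]

end Names

/-! ### Tuples below a view -/

section Materialisation

open VOTree ViewTree

variable {R : Type u} {V : Type v} [DecidableEq V] {σ : Signature R} {Q : CQ σ V} {Dom : Type x}
  {D : Database σ Dom}

theorem VOTree.IsSubVO.exists_tuple_of_children {X : V} {k : ℕ} {c : Fin k → VOTree σ V}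
    {anc : Finset V} {par : Option V} (h : IsSubVO Q (var X k c) anc par) {a : V → Dom}
    (hc : ∀ i, ∀ A ∈ (c i).atoms, ∃ b : V → Dom,
      (∀ Y ∈ (buildViewTree Q (c i) (insert X anc)).schema, b Y = a Y) ∧
        A.args.map b ∈ D.rel A.sym) {A : QAtom σ V} (hA : A ∈ (var X k c).atoms) :
    ∃ b : V → Dom, (∀ Y ∈ insert X (dep Q (var X k c) anc), b Y = a Y) ∧
      A.args.map b ∈ D.rel A.sym := by
  obtain ⟨i, hi⟩ := mem_atoms_var.1 hA
  obtain ⟨b, hb, hbA⟩ := hc i A hi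
  -- Outside the variables of `A`, the valuation can be changed to `a`.
  refine ⟨fun Y => if Y ∈ A.vars then b Y else a Y, fun Y hY => ?_, ?_⟩
  · by_cases hYA : Y ∈ A.vars
    · simp only [hYA, if_true]
      refine hb Y ((h.child i).mem_schema_of_mem_atoms hi hYA ?_)
      rcases Finset.mem_insert.1 hY with rfl | hY
      · exact Finset.mem_insert_self _ _
      · exact Finset.mem_insert_of_mem (mem_dep.1 hY).1
    · simp only [hYA, if_false]
  · convert hbA using 1
    exact List.map_congr_left fun Y hY => if_pos (List.mem_toFinset.2 hY)

/-- Every valuation in a view agrees with some tuple of each atom below the view. -/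
theorem VOTree.IsSubVO.exists_tuple {t : VOTree σ V} {anc : Finset V} {par : Option V}
    (h : IsSubVO Q t anc par) {a : V → Dom} (ha : (buildViewTree Q t anc).Sat D a)
    {A : QAtom σ V} (hA : A ∈ t.atoms) :
    ∃ b : V → Dom, (∀ Y ∈ (buildViewTree Q t anc).schema, b Y = a Y) ∧
      A.args.map b ∈ D.rel A.sym := by
  induction t generalizing anc par a A with
  | atom B =>
    simp only [atoms, Multiset.mem_singleton] at hA
    subst hA
    exact ⟨a, fun _ _ => rfl, ha⟩
  | var X k c ih =>
    obtain ⟨a', h1, h2⟩ := ha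
    obtain ⟨b, h3, h4⟩ := h.exists_tuple_of_children
      (fun i A hA => ih i (h.child i) (h2 i) hA) hA
    exact ⟨b, fun Y hY => (h3 Y (Finset.mem_insert_of_mem hY)).trans (h1 Y hY), h4⟩

theorem one_le_max_size_rpow (Q : CQ σ V) (D : Database σ Dom) (w : ℝ≥0) :
    (1 : ℝ) ≤ ((max 1 (D.size Q) : ℕ) : ℝ) ^ (w : ℝ) :=
  Real.one_le_rpow (by exact_mod_cast le_max_left 1 (D.size Q)) w.2

theorem card_rel_le_size {A : QAtom σ V} (hA : A ∈ Q.body) (D : Database σ Dom) :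
    (D.rel A.sym).card ≤ max 1 (D.size Q) := by
  classical
  refine le_max_of_le_right ?_
  exact Finset.single_le_sum (f := fun r => (D.rel r).card) (fun _ _ => Nat.zero_le _)
    (Finset.mem_image_of_mem _ hA)

theorem VOTree.IsSubVO.leaves_join {X : V} {k : ℕ} {c : Fin k → VOTree σ V} {anc : Finset V}
    (F : Finset V) :
    (ViewTree.join F k fun i => buildViewTree Q (c i) (insert X anc)).leaves =
      (var X k c).atoms := by
  simp [ViewTree.leaves, atoms, leaves_buildViewTree]

/-- The join view `V_X` is contained in the join of the atoms below `X`. -/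
theorem VOTree.IsSubVO.inJoin {X : V} {k : ℕ} {c : Fin k → VOTree σ V} {anc : Finset V}
    {par : Option V} (h : IsSubVO Q (var X k c) anc par) {a : V → Dom}
    (ha : ∀ i, (buildViewTree Q (c i) (insert X anc)).Sat D a) :
    Prog.InJoin D (var X k c).atoms.toFinset (insert X (dep Q (var X k c) anc)).toList
      ((insert X (dep Q (var X k c) anc)).toList.map a) := by
  refine ⟨⟨a, rfl⟩, fun A hA => one_le_matchCount.2 ?_⟩
  obtain ⟨b, h1, h2⟩ := h.exists_tuple_of_children (D := D)
    (fun i A hA => (h.child i).exists_tuple (ha i) hA) (Multiset.mem_toFinset.1 hA)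
  exact ⟨b, h2, List.map_congr_left fun Y hY => h1 Y (Finset.mem_toList.1 hY)⟩

theorem width_le_voWidth {ω : List (VOTree σ V)} {t : VOTree σ V} (ht : t ∈ ω) :
    t.width Q ∅ ≤ voWidth Q ω := by
  induction ω with
  | nil => cases ht
  | cons t' ω ih =>
    change _ ≤ max (t'.width Q ∅) (voWidth Q ω)
    rcases List.mem_cons.1 ht with rfl | ht
    · exact le_max_left _ _
    · exact le_max_of_le_right (ih ht)

theorem exists_injOn_nat (U : Finset V) : ∃ g : V → ℕ, Set.InjOn g U := by
  refine ⟨fun X => U.toList.idxOf X, fun X hX Y _ h => ?_⟩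
  exact (List.idxOf_inj (Finset.mem_toList.2 hX)).1 h

theorem VOTree.IsSubVO.covers {X : V} {k : ℕ} {c : Fin k → VOTree σ V} {anc : Finset V}
    {par : Option V} (h : IsSubVO Q (var X k c) anc par) (D : Database σ Dom) :
    Prog.Covers D (var X k c).atoms.toFinset (insert X (dep Q (var X k c) anc))
      (max 1 (D.size Q)) where
  cover Y hY := by
    obtain ⟨A, hA, hYA⟩ := h.exists_atom hY
    exact ⟨A, Multiset.mem_toFinset.2 hA, hYA⟩
  pos := le_max_left _ _
  card_le A hA := card_rel_le_size (h.atoms_mem A (Multiset.mem_toFinset.1 hA)) D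

theorem target_viewName [Nonempty Dom] {ns : List (ViewTree σ V)} {S : ViewTree σ V} (h : S ∈ ns)
    (t : List Dom) :
    target ns D (viewName ns S) t ↔ ∃ a, S.Sat D a ∧ t = S.cols.map a := by
  have hS := getElem?_viewIndex h
  cases S with
  | atom A =>
    constructor
    · intro ht
      obtain ⟨a, rfl, -⟩ := A.nodup.exists_map_eq ((D.length_eq _ _ ht).trans A.length_eq.symm)
        (fun _ => Classical.arbitrary Dom)
      exact ⟨a, ht, rfl⟩
    · rintro ⟨a, ha, rfl⟩
      exact ha
  | join F k c => simp [viewName, target, hS]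
  | proj F c => simp [viewName, target, hS]

/-! ### Materialisation of the view trees -/

variable [DecidableEq R]

/-- There is a program that, when the views in `Pre` are already materialised, materialises those in
`Post` in time `O(N ^ w)`. -/
def Materialises (Q : CQ σ V) (ns : List (ViewTree σ V)) (Pre Post : Set (ViewTree σ V))
    (w : ℝ≥0) : Prop :=
  ∃ (p : Prog (R ⊕ ℕ)) (K : ℝ), 0 ≤ K ∧ ∀ (Dom : Type x) [DecidableEq Dom] [Nonempty Dom]
    (D : Database σ Dom) (s : PState (R ⊕ ℕ) Dom), s.Sound (target ns D) →
      (∀ r, s.Full (target ns D) (.inl r)) → (∀ S ∈ Pre, s.Full (target ns D) (viewName ns S)) →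
        (p.exec s).1.Sound (target ns D) ∧
        (∀ S ∈ Post, (p.exec s).1.Full (target ns D) (viewName ns S)) ∧
        ((p.exec s).2 : ℝ) ≤ K * ((max 1 (D.size Q) : ℕ) : ℝ) ^ (w : ℝ)

variable {ns : List (ViewTree σ V)} {Pre Post Post' : Set (ViewTree σ V)} {w w' : ℝ≥0}

theorem Materialises.seq (h : Materialises.{u, v, x} Q ns Pre Post w)
    (h' : Materialises.{u, v, x} Q ns (Pre ∪ Post) Post' w) :
    Materialises.{u, v, x} Q ns Pre (Post ∪ Post') w := by
  obtain ⟨p, K, hK, hp⟩ := h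
  obtain ⟨q, L, hL, hq⟩ := h'
  refine ⟨.seq p q, K + L, add_nonneg hK hL, fun Dom _ _ D s hs hb hpre => ?_⟩
  obtain ⟨h1, h2, h3⟩ := hp Dom D s hs hb hpre
  obtain ⟨h4, h5, h6⟩ := hq Dom D _ h1 (fun r => (hb r).mono (Prog.le_exec p s)) (by
    rintro S (hS | hS)
    · exact (hpre S hS).mono (Prog.le_exec p s)
    · exact h2 S hS)
  refine ⟨h4, ?_, ?_⟩
  · rintro S (hS | hS)
    · exact (h2 S hS).mono (Prog.le_exec q _)
    · exact h5 S hS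
  · simp only [Prog.exec, Nat.cast_add]
    linarith

theorem Materialises.mono (h : Materialises.{u, v, x} Q ns Pre Post w) (hw : w ≤ w') :
    Materialises.{u, v, x} Q ns Pre Post w' := by
  obtain ⟨p, K, hK, hp⟩ := h
  refine ⟨p, K, hK, fun Dom _ _ D s hs hb hpre => ?_⟩
  obtain ⟨h1, h2, h3⟩ := hp Dom D s hs hb hpre
  refine ⟨h1, h2, h3.trans (mul_le_mul_of_nonneg_left ?_ hK)⟩
  exact Real.rpow_le_rpow_of_exponent_le (by exact_mod_cast le_max_left 1 (D.size Q))
    (by exact_mod_cast hw)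

theorem Materialises.weaken {Pre' : Set (ViewTree σ V)}
    (h : Materialises.{u, v, x} Q ns Pre Post w) (hpre : Pre ⊆ Pre') (hpost : Post' ⊆ Post) :
    Materialises.{u, v, x} Q ns Pre' Post' w := by
  obtain ⟨p, K, hK, hp⟩ := h
  refine ⟨p, K, hK, fun Dom _ _ D s hs hb hpre' => ?_⟩
  obtain ⟨h1, h2, h3⟩ := hp Dom D s hs hb fun S hS => hpre' S (hpre hS)
  exact ⟨h1, fun S hS => h2 S (hpost hS), h3⟩

theorem materialises_of_atoms (hPost : ∀ S ∈ Post, ∃ A, S = .atom A) (w : ℝ≥0) :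
    Materialises.{u, v, x} Q ns ∅ Post w := by
  refine ⟨.skip, 1, zero_le_one, fun Dom _ _ D s hs hb _ => ⟨hs, fun S hS => ?_, ?_⟩⟩
  · obtain ⟨A, rfl⟩ := hPost S hS
    exact hb A.sym
  · simpa [Prog.exec] using one_le_max_size_rpow Q D w

theorem materialises_list {α : Type*} (l : List α) (P : α → Set (ViewTree σ V))
    (h : ∀ a ∈ l, Materialises.{u, v, x} Q ns ∅ (P a) w) :
    Materialises.{u, v, x} Q ns ∅ {S | ∃ a ∈ l, S ∈ P a} w := by
  induction l with
  | nil => exact materialises_of_atoms (by simp) w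
  | cons a l ih =>
    refine ((h a List.mem_cons_self).seq ((ih fun b hb => h b (List.mem_cons_of_mem _ hb)).weaken
      (Set.empty_subset _) le_rfl)).weaken le_rfl ?_
    rintro S ⟨b, hb, hS⟩
    rcases List.mem_cons.1 hb with rfl | hb
    · exact Or.inl hS
    · exact Or.inr ⟨b, hb, hS⟩

/-- The views `V_X` and `V'_X` can be materialised within the bound given by the fractional edge
cover number of the schema of `V_X`. -/
theorem VOTree.IsSubVO.materialises_node {X : V} {k : ℕ} {c : Fin k → VOTree σ V}
    {anc : Finset V} {par : Option V} (h : IsSubVO Q (var X k c) anc par) (hanc : anc ⊆ Q.vars)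
    (hns : ∀ S : ViewTree σ V, S.IsNode (buildViewTree Q (var X k c) anc) → S ∈ ns) :
    Materialises.{u, v, x} Q ns
      (Set.range fun i => buildViewTree Q (c i) (insert X anc))
      {.join (insert X (dep Q (var X k c) anc)) k fun i => buildViewTree Q (c i) (insert X anc),
        buildViewTree Q (var X k c) anc}
      (fractionalCoverNumber (var X k c).atoms.toFinset
        (insert X (dep Q (var X k c) anc))) := by
  set F := insert X (dep Q (var X k c) anc) with hF
  set E := (var X k c).atoms.toFinset with hE
  set T : Fin k → ViewTree σ V := fun i => buildViewTree Q (c i) (insert X anc) with hT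
  set J : ViewTree σ V := .join F k T with hJ
  set P : ViewTree σ V := .proj (dep Q (var X k c) anc) J with hP
  have hPb : buildViewTree Q (var X k c) anc = P := rfl
  rw [hPb] at hns ⊢
  have hJns : J ∈ ns := hns J (isNode_proj J)
  have hPns : P ∈ ns := hns P (isNode_self P)
  have hTns : ∀ i, T i ∈ ns := fun i => hns _ ((isNode_join T i).trans (isNode_proj J))
  have hJE : J.leaves.toFinset = E := by rw [hE, ← IsSubVO.leaves_join F]
  have hwf : ∀ i, (T i).WellFormed := fun i => (h.child i).wellFormed
  obtain ⟨g, hg⟩ := exists_injOn_nat Q.vars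
  have hFU : F ⊆ Q.vars := Finset.insert_subset (h.vars_mem X (mem_vars_var.2 (Or.inl rfl)))
    fun Y hY => hanc (mem_dep.1 hY).1
  have hEU : ∀ A ∈ E, ∀ Y ∈ A.args, Y ∈ Q.vars := fun A hA Y hY => Finset.mem_biUnion.2
    ⟨A, h.atoms_mem A (Multiset.mem_toFinset.1 hA), List.mem_toFinset.2 hY⟩
  set ch : List ((R ⊕ ℕ) × List V) := List.ofFn fun i => (viewName ns (T i), (T i).cols) with hch
  refine ⟨.seq (Prog.joinView g (freeName ns) E (levelName ns J) ch (viewName ns J) J.cols)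
    (Prog.projView g (viewName ns J) J.cols (viewName ns P) P.cols),
    (J.cols.length + 1) * (2 * E.card + 5) + (ch.length + 3) + 3, by positivity,
    fun Dom _ _ D s hs hb hpre => ?_⟩
  have hcov : Prog.Covers D E F (max 1 (D.size Q)) := h.covers D
  have hcolsF : ∀ Y ∈ J.cols, Y ∈ F := fun Y hY => mem_cols.1 hY
  have hJiff : ∀ t, target ns D (viewName ns J) t ↔ Prog.InJoin D E J.cols t ∧
      ∃ a : V → Dom, t = J.cols.map a ∧ ∀ p ∈ ch, target ns D p.1 (p.2.map a) := by
    intro t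
    have hsat : ∀ a, (∀ p ∈ ch, target ns D p.1 (p.2.map a)) ↔ J.Sat D a := by
      intro a
      rw [hch, List.forall_mem_ofFn_iff]
      exact forall_congr' fun i =>
        (target_viewName (hTns i) _).trans ((hwf i).sat_iff a).symm
    rw [target_viewName hJns]
    constructor
    · rintro ⟨a, ha, rfl⟩
      exact ⟨h.inJoin ha, a, rfl, (hsat a).2 ha⟩
    · rintro ⟨-, a, rfl, ha⟩
      exact ⟨a, (hsat a).1 ha, rfl⟩
  obtain ⟨h1, h2, h3⟩ := Prog.exec_joinView (s := s) hg (fits_target ns D) hs hb hcov J.nodup_cols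
    hFU hcolsF hEU (fun cs hcs t => hJE ▸ target_levelName hJns hcs t) (ch := ch) (by
      rw [hch, List.forall_mem_ofFn_iff]
      refine fun i => ⟨hpre _ ⟨i, rfl⟩, fun Y hY => mem_cols.2 ?_⟩
      change Y ∈ F
      rw [hF, h.insert_dep_eq]
      exact Finset.mem_biUnion.2 ⟨i, Finset.mem_univ i, mem_cols.1 hY⟩) hJiff
  obtain ⟨h4, h5, h6⟩ := Prog.exec_projView (E := E) (vs := J.cols) (ws := P.cols)
    (r := viewName ns J) (r' := viewName ns P) hg h1 hcov J.nodup_cols hFU hcolsF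
    (fun Y hY => mem_cols.2 (Finset.mem_insert_of_mem (mem_cols.1 hY)))
    (fun t ht => ((hJiff t).1 ht).1) h2 (by
      intro t
      rw [target_viewName hPns]
      constructor
      · rintro ⟨a, ⟨b, hba, hb⟩, rfl⟩
        refine ⟨b, (target_viewName hJns _).2 ⟨b, hb, rfl⟩, ?_⟩
        exact List.map_congr_left fun Y hY => (hba Y (mem_cols.1 hY)).symm
      · rintro ⟨a, ha, rfl⟩
        have hwfJ : J.WellFormed := (h.wellFormed).2
        rw [target_viewName hJns] at ha
        exact ⟨a, ⟨a, fun _ _ => rfl, (hwfJ.sat_iff a).2 ha⟩, rfl⟩)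
  refine ⟨h4, ?_, ?_⟩
  · rintro S (rfl | rfl)
    · exact h2.mono (Prog.le_exec _ _)
    · exact h5
  · simp only [Prog.exec, Nat.cast_add]
    linarith

/-- The views of the subtree `t` are materialised bottom-up. -/
theorem VOTree.IsSubVO.materialises {t : VOTree σ V} {anc : Finset V} {par : Option V}
    (h : IsSubVO Q t anc par) (hanc : anc ⊆ Q.vars)
    (hns : ∀ S : ViewTree σ V, S.IsNode (buildViewTree Q t anc) → S ∈ ns) :
    Materialises.{u, v, x} Q ns ∅ {S | S.IsNode (buildViewTree Q t anc)} (t.width Q anc) := by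
  induction t generalizing anc par with
  | atom A => exact materialises_of_atoms (fun S hS => ⟨A, hS.eq_of_atom⟩) _
  | var X k c ih =>
    have hX : X ∈ Q.vars := h.vars_mem X (mem_vars_var.2 (Or.inl rfl))
    have hchild : ∀ i, (buildViewTree Q (c i) (insert X anc)).IsNode
        (buildViewTree Q (var X k c) anc) := fun i =>
      (isNode_join (fun i => buildViewTree Q (c i) (insert X anc)) i).trans (isNode_proj _)
    have h1 := materialises_list (w := (var X k c).width Q anc) (List.finRange k)
      (fun i => {S : ViewTree σ V | S.IsNode (buildViewTree Q (c i) (insert X anc))})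
      fun i _ => (ih i (h.child i) (Finset.insert_subset hX hanc)
        fun S hS => hns S (hS.trans (hchild i))).mono (le_max_of_le_right
          (Finset.le_sup (f := fun i => (c i).width Q (insert X anc)) (Finset.mem_univ i)))
    have h2 : Materialises.{u, v, x} Q ns _ _ ((var X k c).width Q anc) :=
      (h.materialises_node hanc hns).mono (le_max_left _ _)
    refine (h1.seq (h2.weaken ?_ le_rfl)).weaken le_rfl ?_
    · rintro S ⟨i, rfl⟩
      exact Or.inr ⟨i, List.mem_finRange i, isNode_self _⟩
    · intro S hS
      rcases hS.cases_proj with h3 | h3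
      · exact Or.inr (Or.inr h3)
      · rcases h3.cases_join with h4 | ⟨i, hi⟩
        · exact Or.inr (Or.inl h4)
        · exact Or.inl ⟨i, List.mem_finRange i, hi⟩

theorem materialisableInTime_rewriteVO {ω : List (VOTree σ V)} (h : IsVO Q ω) :
    MaterialisableInTime.{u, v, x} Q (rewriteVO Q ω) (voWidth Q ω) := by
  have hfin : {S : ViewTree σ V | ∃ T ∈ rewriteVO Q ω, S.IsNode T}.Finite := by
    have := (rewriteVO Q ω).finite_toSet.biUnion fun T _ => T.finite_isNode
    refine this.subset fun S hS => ?_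
    obtain ⟨T, hT, hS⟩ := hS
    exact Set.mem_biUnion hT hS
  set ns := hfin.toFinset.toList with hns
  have hmem : ∀ T ∈ rewriteVO Q ω, ∀ S : ViewTree σ V, S.IsNode T → S ∈ ns := fun T hT S hS => by
    rw [hns, Finset.mem_toList, Set.Finite.mem_toFinset]
    exact ⟨T, hT, hS⟩
  obtain ⟨p, K, -, hp⟩ := materialises_list.{u, v, x} (ns := ns) (w := voWidth Q ω) ω
    (fun t => {S : ViewTree σ V | S.IsNode (buildViewTree Q t ∅)})
    fun t ht => ((h.isSubVO ht).materialises (by simp)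
      (hmem _ (List.mem_map_of_mem ht))).mono (width_le_voWidth ht)
  refine ⟨p, viewName ns, ViewTree.cols, K, fun T _ S _ => ⟨S.nodup_cols, S.toFinset_cols⟩,
    fun Dom _ _ D s hs => ?_⟩
  obtain ⟨h1, h2, h3⟩ := hp Dom D s (hs.sound ns) (fun r t ht => ((hs.1 r).2 t).2 ht) (by simp)
  refine ⟨fun T hT S hS => ⟨(h1 _).1, fun t => ?_⟩, by exact_mod_cast h3⟩
  rw [← target_viewName (hmem T hT S hS)]
  refine ⟨(h1 _).2 t, h2 S ?_ t⟩
  obtain ⟨t', ht', rfl⟩ := List.mem_map.1 hT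
  exact ⟨t', ht', hS⟩

end Materialisation

theorem mainTheorem7 {R : Type u} {V : Type v} [DecidableEq R] [DecidableEq V]
    (σ : Signature R) (Q : CQ σ V) (hQ : Q.WellBehaved)
    (ω : List (VOTree σ V)) (hω : IsWellStructuredVO Q ω) :
    IsSafeRewriting Q (rewriteVO Q ω) ∧
    MaterialisableInTime.{u, v, x} Q (rewriteVO Q ω) (voWidth Q ω) ∧
    ∃ ω₀ : List (VOTree σ V), IsWellStructuredVO Q ω₀ ∧
      voWidth Q ω₀ = preprocessingWidth Q ∧
      IsSafeRewriting Q (rewriteVO Q ω₀) ∧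
      MaterialisableInTime.{u, v, x} Q (rewriteVO Q ω₀) (preprocessingWidth Q) := by
  obtain ⟨ω₀, h₀, hw⟩ := exists_voWidth_eq hω
  exact ⟨isSafeRewriting_rewriteVO hω, materialisableInTime_rewriteVO hω.1, ω₀, h₀, hw,
    isSafeRewriting_rewriteVO h₀, hw ▸ materialisableInTime_rewriteVO h₀.1⟩
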